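/- **Setting.** A (finitary) algebraic type $V$ is given by operators of finite arity together with equations between the operators derived from them. $V$ is *self-enhancing* if, for all $V$-algebras $A,B$, the set of homomorphisms $A\to B$ is closed under the pointwise operations (and so is a $V$-algebra, with bilinear composition). Fix a self-enhancing $V$. A *$W$-algebra* is a commutative monoid object in $V$-algebras, that is, a $V$-algebra $R$ with a commutative monoid structure such that $a\cdot\varphi(b_1,\dots,b_n)=\varphi(ab_1,\dots,ab_n)$ for every $n$-ary operator $\varphi$ of $V$; homomorphisms respect both structures. An *ideal* of $R$ is a subset closed under the operators of $V$ and under multiplication by $R$. Finitely generated ideals form a semiring under sum and product, with unit ideal $R$. For a submonoid $S\subseteq R$, $S^{-1}R$ is the localization, and $R_f$ is the localization at the powers of $f$. Distributive lattices have $0$ and $1$, and their homomorphisms preserve them. A *coherent space* is a spectral space, and its morphisms are the quasi-compact continuous maps. For a quasi-compact open $U\subseteq X$, $\Omega_c(U)$ is the lattice of quasi-compact open subsets of $U$, and $\tau_X$ is the sheaf of distributive lattices $U\mapsto\Omega_c(U)$ on $X$. Sheaves on $X$ are sheaves on its quasi-compact open subsets. Given a functor $L$ from $W$-algebras to distributive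 lattices and a sheaf $\mathcal O$ of $W$-algebras, $L\mathcal O$ denotes the sheafification of $U\mapsto L(\mathcal O(U))$. Consider triples $(X,\mathcal O_X,\beta_X)$, where $X$ is a coherent space, $\mathcal O_X$ a sheaf of $W$-algebras on $X$, and $\beta_X:L\mathcal O_X\to\tau_X$ a morphism of sheaves of distributive lattices. A morphism $(X,\mathcal O_X,\beta_X)\to(Y,\mathcal O_Y,\beta_Y)$ is a pair $(f,f^\#)$ of a quasi-compact continuous map $f:X\to Y$ and a morphism $f^\#:\mathcal O_Y\to f_*\mathcal O_X$ of sheaves of $W$-algebras such that the two composites $L\mathcal O_Y\to f_*L\mathcal O_X\to f_*\tau_X$ (from $f^\#$ and $f_*\beta_X$) and $L\mathcal O_Y\to\tau_Y\to f_*\tau_X$ (from $\beta_Y$ and $T\mapsto f^{-1}(T)$) coincide. **$\mathscr A$-schemes.** Let $\alpha_1(R)$ be the set of finitely generated ideals of $R$ modulo the relation $\mathfrak a\equiv\mathfrak b\iff\mathfrak a^n\subseteq\mathfrak b$ and $\mathfrak b^n\subseteq\mathfrak a$ for $n\gg0$. It is a distributive lattice with join and meet induced by sum and product. Let $\alpha_2:R\to\alpha_1(R)$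 send $a$ to the class of the principal ideal generated by $a$. Both are natural in $R$ and, for every submonoid $S$, $\alpha_1(R)\to\alpha_1(S^{-1}R)$ identifies $\alpha_1(S^{-1}R)$ with the localization of $\alpha_1(R)$ at $\alpha_2(S)$ (call this identification $\gamma$), so $\mathscr A=(W,\alpha_1,\alpha_2,\gamma)$ is a schematizable algebraic type. An *$\mathscr A$-scheme* is a triple as above with $L=\alpha_1$ such that, for all quasi-compact open $T\subseteq U$, the restriction $\mathcal O_X(U)\to\mathcal O_X(T)$ factors through the localization of $\mathcal O_X(U)$ by the multiplicative system $\{f\in\mathcal O_X(U)\mid\beta_X(\alpha_2(f))\supseteq T\}$. **Weak $\mathscr C$-schemes.** Let $\mathscr C$ be the opposite of the category of $W$-algebras, with its *Zariski topology*: $\mathscr E$ consists of the localizations of finite type $S^{-1}R\to R$ (with $S$ finitely generated), and the coverings of $R$ are the finite sets $\{R_{f_i}\to R\}_i$ of $\mathscr E$-morphisms such that the $f_i$ generate the unit ideal. Let $\Omega_1(R)$ be the set of finite sets of $\mathscr E$-morphisms to $R$, ordered by $$\{U_i\}_i\prec\{V_j\}_j\iff\{U_i\times_RV_j\to U_i\}_j\text{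 is a covering of }U_i\text{ for every }i,$$ modulo the equivalence $x\prec y\prec x$. It is a distributive lattice with join $\{U_i\}_{i\in I\amalg J}$ and meet $\{U_i\times_RV_j\}_{i,j}$, functorial in $R$ by base change. A *weak $\mathscr C$-scheme* is a triple as above with $L=\Omega_1$ such that, for all quasi-compact open $T\subseteq U$ and every $\mathscr E$-morphism $j:A\to\mathcal O_X(U)$ with $\beta_X(U)(\{j\})\supseteq T$, the restriction, as a morphism $\mathcal O_X(T)\to\mathcal O_X(U)$ of $\mathscr C$, factors through $j$. **Theorem 4.16.** For every self-enhancing algebraic type $V$, the category of $\mathscr A$-schemes is equivalent to the category of weak $\mathscr C$-schemes. -/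

import Mathlib

open CategoryTheory Opposite TopologicalSpace
universe u

noncomputable section

/-! ### Sheafification of lattice-valued presheaves -/
namespace DLat

/-- A bounded distributive lattice, regarded as a semiring with `+ = ⊔` and `* = ⊓`. -/
def AsSemiring (L : Type u) : Type u := L

instance (L : Type u) [DistribLattice L] [BoundedOrder L] : CommSemiring (AsSemiring L) where
  add a b := (max a b : L)
  mul a b := (min a b : L)
  zero := (⊥ : L)
  one := (⊤ : L)
  nsmul n a := Nat.rec (⊥ : L) (fun _ b => (max b a : L)) n
  npow n a := Nat.rec (⊤ : L) (fun _ b => (min b a : L)) n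
  nsmul_zero _ := rfl
  nsmul_succ _ _ := rfl
  npow_zero _ := rfl
  npow_succ _ _ := rfl
  add_assoc := sup_assoc (α := L)
  zero_add := bot_sup_eq (α := L)
  add_zero := sup_bot_eq (α := L)
  add_comm := sup_comm (α := L)
  left_distrib := inf_sup_left (α := L)
  right_distrib := inf_sup_right (α := L)
  zero_mul := bot_inf_eq (α := L)
  mul_zero := inf_bot_eq (α := L)
  mul_assoc := inf_assoc (α := L)
  one_mul := top_inf_eq (α := L)
  mul_one := inf_top_eq (α := L)
  mul_comm := inf_comm (α := L)

/-- The fully faithful functor from bounded distributive lattices to commutative semirings. -/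
def toSemiring : BddDistLat.{u} ⥤ CommSemiRingCat.{u} where
  obj L := CommSemiRingCat.of (AsSemiring L)
  map f := CommSemiRingCat.ofHom
    { toFun := fun x => f x
      map_one' := map_top f.hom
      map_zero' := map_bot f.hom
      map_mul' := f.hom.map_inf'
      map_add' := f.hom.map_sup' }

instance : toSemiring.{u}.Faithful where
  map_injective {X Y f g} h := by
    ext x
    exact congrArg (fun k => k.hom x) h

instance : toSemiring.{u}.Full where
  map_surjective g := ⟨BddDistLat.ofHom
    { toFun := fun x => g.hom x
      map_top' := g.hom.map_one
      map_bot' := g.hom.map_zero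
      map_inf' := g.hom.map_mul
      map_sup' := g.hom.map_add }, rfl⟩

/-- A commutative semiring with `x * x = x` and `1 + x = 1` is a bounded distributive lattice. -/
@[reducible] def latticeOfSemiring (R : Type u) [CommSemiring R] (h1 : ∀ x : R, x * x = x)
    (h2 : ∀ x : R, 1 + x = 1) : DistribLattice R :=
  have h3 : ∀ x y : R, x + x * y = x := fun x y => by
    rw [← mul_one_add, h2, mul_one]
  letI : Max R := ⟨(· + ·)⟩
  letI : Min R := ⟨(· * ·)⟩
  letI l : Lattice R := Lattice.mk' (fun a b => add_comm a b) (fun a b c => add_assoc a b c)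
    (fun a b => mul_comm a b) (fun a b c => mul_assoc a b c) (fun a b => h3 a b)
    (fun a b => by change a * (a + b) = a; rw [mul_add, h1, h3])
  DistribLattice.ofInfSupLe fun a b c => (mul_add a b c).le

/-- The bounds of the lattice `latticeOfSemiring`. -/
@[reducible] def boundedOfSemiring (R : Type u) [CommSemiring R] (h1 : ∀ x : R, x * x = x)
    (h2 : ∀ x : R, 1 + x = 1) :
    letI := latticeOfSemiring R h1 h2
    BoundedOrder R :=
  letI := latticeOfSemiring R h1 h2
  { top := 1
    bot := 0
    le_top := fun a => inf_eq_left.mp (mul_one a)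
    bot_le := fun a => sup_eq_right.mp (zero_add a) }

lemma exists_iso (R : CommSemiRingCat.{u}) (h1 : ∀ x : R, x * x = x) (h2 : ∀ x : R, 1 + x = 1) :
    ∃ L : BddDistLat.{u}, Nonempty (toSemiring.obj L ≅ R) := by
  let := latticeOfSemiring R h1 h2
  let := boundedOfSemiring R h1 h2
  refine ⟨BddDistLat.of R, ⟨RingEquiv.toCommSemiRingCatIso
    (R := CommSemiRingCat.of (AsSemiring R)) (S := R)
    { toFun := fun x => x
      invFun := fun x => x
      left_inv := fun _ => rfl
      right_inv := fun _ => rfl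
      map_mul' := fun _ _ => rfl
      map_add' := fun _ _ => rfl }⟩⟩

lemma idem (L : BddDistLat.{u}) (x : toSemiring.obj L) : x * x = x := inf_idem (α := L) x
lemma absorb (L : BddDistLat.{u}) (x : toSemiring.obj L) : 1 + x = 1 := top_sup_eq (α := L) x

open Limits

variable {J : Type u} [SmallCategory J]

instance (F : J ⥤ BddDistLat.{u}) : CreatesLimit F toSemiring.{u} := by
  have h := exists_iso (limit (F ⋙ toSemiring))
    (fun x => Concrete.limit_ext _ _ _ fun j => by
      simpa using idem (F.obj j) (limit.π (F ⋙ toSemiring) j x))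
    (fun x => Concrete.limit_ext _ _ _ fun j => by
      simpa using absorb (F.obj j) (limit.π (F ⋙ toSemiring) j x))
  exact createsLimitOfFullyFaithfulOfIso h.choose h.choose_spec.some

instance [IsFiltered J] : HasColimitsOfShape J CommSemiRingCat.{u} where
  has_colimit F := ⟨⟨_, CommSemiRingCat.FilteredColimits.colimitCoconeIsColimit.{u, u} F⟩⟩

instance [IsFiltered J] (F : J ⥤ BddDistLat.{u}) : CreatesColimit F toSemiring.{u} := by
  have h := exists_iso (colimit (F ⋙ toSemiring))
    (fun x => by
      obtain ⟨j, y, rfl⟩ := Concrete.colimit_exists_rep _ x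
      rw [← map_mul]; exact congrArg _ (idem (F.obj j) y))
    (fun x => by
      obtain ⟨j, y, rfl⟩ := Concrete.colimit_exists_rep _ x
      rw [← map_one (colimit.ι (F ⋙ toSemiring) j).hom, ← map_add]
      exact congrArg _ (absorb (F.obj j) y))
  exact createsColimitOfFullyFaithfulOfIso h.choose h.choose_spec.some

instance : HasLimitsOfShape J BddDistLat.{u} where
  has_limit F := hasLimit_of_created F toSemiring

instance [IsFiltered J] : HasColimitsOfShape J BddDistLat.{u} where
  has_colimit F := hasColimit_of_created F toSemiring

instance : HasLimits BddDistLat.{u} where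

/-- The two underlying-set functors agree. -/
def forgetIso : toSemiring.{u} ⋙ forget CommSemiRingCat.{u} ≅ forget BddDistLat.{u} := Iso.refl _

instance : PreservesLimits (forget BddDistLat.{u}) where
  preservesLimitsOfShape :=
    { preservesLimit := fun {F} =>
        preservesLimit_of_natIso (h := forgetIso) F }

instance [IsFiltered J] : PreservesColimitsOfShape J (forget BddDistLat.{u}) where
  preservesColimit {F} := preservesColimit_of_natIso (h := forgetIso) F

instance : (forget BddDistLat.{u}).ReflectsIsomorphisms where
  reflects {X Y} f hf := by
    have : IsIso ((toSemiring ⋙ forget CommSemiRingCat).map f) := hf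
    exact isIso_of_reflects_iso f (toSemiring ⋙ forget CommSemiRingCat)

variable {C : Type u} [SmallCategory C] (J : GrothendieckTopology C)

instance : HasSheafify J BddDistLat.{u} := inferInstance

end DLat
/-! ### Coherent spaces and sheaves on their quasi-compact open subsets -/
namespace Coh

variable (X : Type u) [TopologicalSpace X] [SpectralSpace X]

instance : DistribLattice (CompactOpens X) :=
  { (inferInstance : SemilatticeSup (CompactOpens X)),
    (inferInstance : SemilatticeInf (CompactOpens X)) with
    le_sup_inf := fun a b c x hx => by
      rcases hx with ⟨h1 | h1, h2 | h2⟩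
      · exact Or.inl h1
      · exact Or.inl h1
      · exact Or.inl h2
      · exact Or.inr ⟨h1, h2⟩ }

lemma exists_compactOpens (U : Set X) (hU : IsOpen U) (x : X) (hx : x ∈ U) :
    ∃ W : CompactOpens X, x ∈ W ∧ (W : Set X) ⊆ U := by
  obtain ⟨W, ⟨h1, h2⟩, h3, h4⟩ :=
    (PrespectralSpace.isTopologicalBasis (X := X)).exists_subset_of_mem_open hx hU
  exact ⟨⟨⟨W, h2⟩, h1⟩, h3, h4⟩

/-- The Grothendieck topology on the poset of quasi-compact open subsets of a coherent space: a
sieve on `U` is covering if its members have union `U` (equivalently, since `U` is quasi-compact,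
if finitely many of its members have union `U`). -/
def topology : GrothendieckTopology (CompactOpens X) where
  sieves U := {S | ∀ x ∈ U, ∃ (V : CompactOpens X) (f : V ⟶ U), S f ∧ x ∈ V}
  top_mem' U := fun x hx => ⟨U, 𝟙 U, trivial, hx⟩
  pullback_stable' U V S f hS := fun x hx => by
    obtain ⟨W, g, hg, hW⟩ := hS x (leOfHom f hx)
    exact ⟨W ⊓ V, homOfLE inf_le_right,
      S.downward_closed hg (homOfLE (inf_le_left : W ⊓ V ≤ W)), hW, hx⟩
  transitive' U S hS R hR := fun x hx => by
    obtain ⟨V, f, hf, hV⟩ := hS x hx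
    obtain ⟨W, g, hg, hW⟩ := hR hf x hV
    exact ⟨W, g ≫ f, hg, hW⟩

/-- The lattice `Ω_c(U)` of the quasi-compact open subsets of the quasi-compact open `U`. -/
def Below {X : Type u} [TopologicalSpace X] (U : CompactOpens X) : Type u :=
  {W : CompactOpens X // W ≤ U}

variable {X} in
instance (U : CompactOpens X) : DistribLattice (Below U) :=
  letI : Max (Below U) := ⟨fun a b => ⟨a.1 ⊔ b.1, sup_le a.2 b.2⟩⟩
  letI : Min (Below U) := ⟨fun a b => ⟨a.1 ⊓ b.1, inf_le_left.trans a.2⟩⟩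
  letI : LE (Below U) := ⟨fun a b => a.1 ≤ b.1⟩
  letI : LT (Below U) := ⟨fun a b => a.1 < b.1⟩
  Subtype.val_injective.distribLattice (fun a : Below U => a.1) Iff.rfl Iff.rfl
    (fun _ _ => rfl) (fun _ _ => rfl)

variable {X} in
instance (U : CompactOpens X) : BoundedOrder (Below U) where
  top := ⟨U, le_rfl⟩
  bot := ⟨⊥, bot_le⟩
  le_top a := a.2
  bot_le a := (bot_le : ⊥ ≤ a.1)

/-- The presheaf `U ↦ Ω_c(U)`, with restriction maps `W ↦ W ∩ V`. -/
def tauPresheaf : (CompactOpens X)ᵒᵖ ⥤ BddDistLat.{u} where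
  obj U := BddDistLat.of (Below U.unop)
  map {U V} f := BddDistLat.ofHom
    { toFun := fun W => ⟨W.1 ⊓ V.unop, inf_le_right⟩
      map_sup' := fun a b => Subtype.ext (inf_sup_right a.1 b.1 V.unop)
      map_inf' := fun a b => Subtype.ext (inf_inf_distrib_right a.1 b.1 V.unop)
      map_top' := Subtype.ext (inf_eq_right.mpr (leOfHom f.unop))
      map_bot' := Subtype.ext (bot_inf_eq _) }
  map_id U := by
    ext W
    exact Subtype.ext (inf_eq_left.mpr W.2)
  map_comp {U V T} f g := by
    ext W
    refine Subtype.ext ?_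
    change W.1 ⊓ T.unop = W.1 ⊓ V.unop ⊓ T.unop
    rw [inf_assoc, inf_eq_right.mpr (leOfHom g.unop)]

lemma tau_isSheaf : Presheaf.IsSheaf (topology X) (tauPresheaf X) := by
  rw [Presheaf.isSheaf_iff_isSheaf_forget _ _ (forget BddDistLat.{u})]
  rw [isSheaf_iff_isSheaf_of_type]
  intro U S hS x hx
  have key : ∀ (V V' : CompactOpens X) (f : V ⟶ U) (f' : V' ⟶ U) (h : S f) (h' : S f'),
      (x f h).1 ⊓ V' = (x f' h').1 ⊓ V := by
    intro V V' f f' h h'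
    have := hx (homOfLE (inf_le_left : V ⊓ V' ≤ V)) (homOfLE (inf_le_right : V ⊓ V' ≤ V')) h h'
      (Subsingleton.elim _ _)
    have := congrArg Subtype.val this
    change (x f h).1 ⊓ (V ⊓ V') = (x f' h').1 ⊓ (V ⊓ V') at this
    rw [← inf_assoc, inf_eq_left.mpr (x f h).2, inf_comm V, ← inf_assoc,
      inf_eq_left.mpr (x f' h').2] at this
    exact this
  choose! V f hf hV using hS
  have hU : (U : Set X) ⊆ ⋃ p : {p // p ∈ U}, (V p.1 : Set X) := fun p hp =>
    Set.mem_iUnion.mpr ⟨⟨p, hp⟩, hV p hp⟩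
  obtain ⟨t, ht⟩ := U.isCompact.elim_finite_subcover _ (fun p : {p // p ∈ U} => (V p.1).isOpen) hU
  let W : CompactOpens X := t.sup fun p => (x (f p.1 p.2) (hf p.1 p.2)).1
  have hmem : ∀ p, p ∈ W ↔ ∃ q ∈ t, p ∈ (x (f q.1 q.2) (hf q.1 q.2)).1 := fun p => by
    rw [← SetLike.mem_coe, CompactOpens.coe_finsetSup]; simp
  have hWU : W ≤ U := Finset.sup_le fun p _ => (x (f p.1 p.2) (hf p.1 p.2)).2.trans
    (leOfHom (f p.1 p.2))
  refine ⟨⟨W, hWU⟩, ?_, ?_⟩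
  · intro T g hg
    refine Subtype.ext (SetLike.ext fun p => ?_)
    change p ∈ W ∧ p ∈ T ↔ _
    constructor
    · rintro ⟨h1, h2⟩
      obtain ⟨q, hq, h3⟩ := (hmem p).mp h1
      have : p ∈ (x (f q.1 q.2) (hf q.1 q.2)).1 ⊓ T := ⟨h3, h2⟩
      rw [key _ _ _ g _ hg] at this
      exact this.1
    · intro h1
      have h2 : p ∈ T := (x g hg).2 h1
      obtain ⟨q, hq⟩ := Set.mem_iUnion.mp (ht (leOfHom g h2))
      obtain ⟨hqt, h3⟩ := Set.mem_iUnion.mp hq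
      refine ⟨(hmem p).mpr ⟨q, hqt, ?_⟩, h2⟩
      have : p ∈ (x g hg).1 ⊓ V q.1 := ⟨h1, h3⟩
      rw [key _ _ g (f q.1 q.2) hg (hf q.1 q.2)] at this
      exact this.1
  · intro W' hW'
    refine Subtype.ext (SetLike.ext fun p => ?_)
    have hr : ∀ q (hq : q ∈ U), W'.1 ⊓ V q = (x (f q hq) (hf q hq)).1 := fun q hq =>
      congrArg Subtype.val (hW' (f q hq) (hf q hq))
    rw [hmem]
    constructor
    · intro h1
      have h2 : p ∈ U := W'.2 h1
      obtain ⟨q, hq⟩ := Set.mem_iUnion.mp (ht h2)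
      obtain ⟨hqt, h3⟩ := Set.mem_iUnion.mp hq
      refine ⟨q, hqt, ?_⟩
      rw [← hr]
      exact ⟨h1, h3⟩
    · rintro ⟨q, _, h⟩
      rw [← hr] at h
      exact h.1

/-- The canonical sheaf of distributive lattices `τ` on a coherent space. -/
def tau : Sheaf (topology X) BddDistLat.{u} := ⟨tauPresheaf X, tau_isSheaf X⟩

variable {X} {Y Z : Type u} [TopologicalSpace Y] [SpectralSpace Y]
  [TopologicalSpace Z] [SpectralSpace Z]

/-- The preimage of a quasi-compact open subset under a quasi-compact continuous map. -/
def preimage (f : X → Y) (hf : IsSpectralMap f) (U : CompactOpens Y) : CompactOpens X :=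
  ⟨⟨f ⁻¹' U, hf.isCompact_preimage_of_isOpen U.isOpen U.isCompact⟩,
    U.isOpen.preimage hf.continuous⟩

/-- The preimage functor on quasi-compact open subsets. -/
def preimageFunctor (f : X → Y) (hf : IsSpectralMap f) : CompactOpens Y ⥤ CompactOpens X where
  obj U := preimage f hf U
  map h := homOfLE (fun _ hx => leOfHom h hx)

instance (f : X → Y) (hf : IsSpectralMap f) :
    (preimageFunctor f hf).IsContinuous (topology Y) (topology X) := by
  refine Functor.isContinuous_of_coverPreserving ⟨?_⟩ ⟨?_⟩
  · intro F Z T x hx Y₁ Y₂ W f₁ f₂ g₁ g₂ h₁ h₂ _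
    have hW : W ≤ preimage f hf (Y₁ ⊓ Y₂) := le_inf (leOfHom f₁) (leOfHom f₂)
    have := hx (homOfLE (inf_le_left : Y₁ ⊓ Y₂ ≤ Y₁)) (homOfLE (inf_le_right : Y₁ ⊓ Y₂ ≤ Y₂))
      h₁ h₂ (Subsingleton.elim _ _)
    have := congrArg (F.obj.map (homOfLE hW :
      W ⟶ (preimageFunctor f hf).obj (Y₁ ⊓ Y₂)).op) this
    simp only [Functor.comp_map, ← types_comp_apply, ← Functor.map_comp] at this
    exact this
  · intro _ S hS x hx
    obtain ⟨V, g, hg, hV⟩ := hS (f x) hx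
    exact ⟨preimage f hf V, (preimageFunctor f hf).map g,
      Sieve.image_mem_functorPushforward _ _ hg, hV⟩

/-- The direct image of a sheaf under a quasi-compact continuous map. -/
abbrev pushforward {D : Type (u + 1)} [Category.{u} D] (f : X → Y) (hf : IsSpectralMap f) :
    Sheaf (topology X) D ⥤ Sheaf (topology Y) D :=
  (preimageFunctor f hf).sheafPushforwardContinuous D (topology Y) (topology X)

/-- The morphism `f⁻¹ : τ_Y → f_* τ_X`, given by `Ω_c(U) → Ω_c(f⁻¹ U)`, `V ↦ f⁻¹ V`. -/
def tauMap (f : X → Y) (hf : IsSpectralMap f) : tau Y ⟶ (pushforward f hf).obj (tau X) where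
  hom :=
    { app := fun _ => BddDistLat.ofHom
        { toFun := fun W => ⟨preimage f hf W.1, fun _ hx => W.2 hx⟩
          map_sup' := fun _ _ => rfl
          map_inf' := fun _ _ => rfl
          map_top' := rfl
          map_bot' := rfl }
      naturality := fun _ _ _ => rfl }

end Coh
/-! ### Coherent spaces with a structure sheaf and a support morphism -/
namespace Coh

variable {D : Type (u + 1)} [Category.{u} D] (L : D ⥤ BddDistLat.{u})

section
variable {X Y : Type u} [TopologicalSpace X] [SpectralSpace X] [TopologicalSpace Y]
  [SpectralSpace Y]

/-- The sheaf of distributive lattices obtained by applying `L` to a `D`-valued sheaf, namely the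
sheafification of `U ↦ L (O U)`. -/
def latticeSheaf (O : Sheaf (topology X) D) : Sheaf (topology X) BddDistLat.{u} :=
  (presheafToSheaf (topology X) BddDistLat.{u}).obj (O.obj ⋙ L)

/-- The canonical map from `L (O U)` to the sections over `U` of the sheafification. -/
def toLatticeSheaf (O : Sheaf (topology X) D) : O.obj ⋙ L ⟶ (latticeSheaf L O).obj :=
  toSheafify (topology X) (O.obj ⋙ L)

/-- The map of lattice sheaves induced by a map `O_Y → f_* O_X`, given on presheaves by
`L (O_Y U) → L (O_X (f⁻¹ U))`. -/
def latticeSheafMap (f : X → Y) (hf : IsSpectralMap f) {OY : Sheaf (topology Y) D}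
    {OX : Sheaf (topology X) D} (φ : OY ⟶ (pushforward f hf).obj OX) :
    latticeSheaf L OY ⟶ (pushforward f hf).obj (latticeSheaf L OX) :=
  ⟨sheafifyLift (topology Y)
    (Functor.whiskerRight φ.hom L ≫
      Functor.whiskerLeft (preimageFunctor f hf).op (toLatticeSheaf L OX))
    ((pushforward f hf).obj (latticeSheaf L OX)).property⟩

/-- The quasi-compact open subset `β(U)(a)` of `U`, for `a ∈ L (O U)`. -/
def supp {O : Sheaf (topology X) D} (β : latticeSheaf L O ⟶ tau X) {U : CompactOpens X}
    (a : L.obj (O.obj.obj (op U))) : CompactOpens X :=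
  Subtype.val (p := fun W => W ≤ U) (β.hom.app (op U) ((toLatticeSheaf L O).app (op U) a))

lemma comm_iff (f : X → Y) (hf : IsSpectralMap f) {OY : Sheaf (topology Y) D}
    {OX : Sheaf (topology X) D} (φ : OY ⟶ (pushforward f hf).obj OX)
    (βY : latticeSheaf L OY ⟶ tau Y) (βX : latticeSheaf L OX ⟶ tau X) :
    latticeSheafMap L f hf φ ≫ (pushforward f hf).map βX = βY ≫ tauMap f hf ↔
      ∀ (U : CompactOpens Y) (a : L.obj (OY.obj.obj (op U))),
        supp L βX (U := preimage f hf U) (L.map (φ.hom.app (op U)) a) =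
          preimage f hf (supp L βY a) := by
  have h1 : toLatticeSheaf L OY ≫ (latticeSheafMap L f hf φ).hom =
      Functor.whiskerRight φ.hom L ≫
        Functor.whiskerLeft (preimageFunctor f hf).op (toLatticeSheaf L OX) :=
    toSheafify_sheafifyLift _ _ _
  have h2 : ∀ (U : CompactOpens Y) (a : L.obj (OY.obj.obj (op U))),
      (latticeSheafMap L f hf φ).hom.app (op U) ((toLatticeSheaf L OY).app (op U) a) =
      (toLatticeSheaf L OX).app (op (preimage f hf U)) (L.map (φ.hom.app (op U)) a) :=
    fun U a => congrArg (fun k => k.app (op U) a) h1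
  constructor
  · intro h U a
    have h3 := congrArg (fun k => k.hom.app (op U) ((toLatticeSheaf L OY).app (op U) a)) h
    have h4 := congrArg (βX.hom.app (op (preimage f hf U))) (h2 U a)
    exact congrArg Subtype.val (h4.symm.trans h3)
  · intro h
    refine Sheaf.hom_ext (sheafify_hom_ext _ _ _ ((pushforward f hf).obj (tau X)).property ?_)
    ext U a
    have h4 := congrArg (βX.hom.app (op (preimage f hf U.unop))) (h2 U.unop a)
    exact h4.trans (Subtype.ext (h U.unop a))

end

/-- A coherent space `X` with a `D`-valued sheaf `O` and a morphism `β : L O → τ` of sheaves of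
distributive lattices, the support morphism. -/
structure SupportedSpace where
  carrier : Type u
  [topologicalSpace : TopologicalSpace carrier]
  [spectralSpace : SpectralSpace carrier]
  O : Sheaf (topology carrier) D
  β : latticeSheaf L O ⟶ tau carrier

attribute [instance] SupportedSpace.topologicalSpace SupportedSpace.spectralSpace

namespace SupportedSpace

variable {L}

/-- The quasi-compact open subset `β_X(U)(a)` of `U`, for `a ∈ L (O_X(U))`. -/
abbrev support (X : SupportedSpace L) {U : CompactOpens X.carrier}
    (a : L.obj (X.O.obj.obj (op U))) : CompactOpens X.carrier :=
  supp L X.β a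

/-- A morphism `(f, f^♯)`: a quasi-compact continuous map and a map `f^♯ : O_Y → f_* O_X` of
sheaves that are compatible with the support morphisms. -/
@[ext]
structure Hom (X Y : SupportedSpace L) where
  base : X.carrier → Y.carrier
  isSpectralMap : IsSpectralMap base
  sharp : Y.O ⟶ (pushforward base isSpectralMap).obj X.O
  comm : latticeSheafMap L base isSpectralMap sharp ≫ (pushforward base isSpectralMap).map X.β =
    Y.β ≫ tauMap base isSpectralMap

/-- The identity morphism. -/
def Hom.id (X : SupportedSpace L) : Hom X X where
  base := _root_.id
  isSpectralMap := isSpectralMap_id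
  sharp := ⟨𝟙 X.O.obj⟩
  comm := by
    rw [comm_iff]
    intro U a
    exact congrArg (fun k => supp L X.β (k a)) (L.map_id _)

/-- The composite of two morphisms. -/
def Hom.comp {X Y Z : SupportedSpace L} (f : Hom X Y) (g : Hom Y Z) : Hom X Z where
  base := g.base ∘ f.base
  isSpectralMap := g.isSpectralMap.comp f.isSpectralMap
  sharp := ⟨g.sharp.hom ≫ ((pushforward g.base g.isSpectralMap).map f.sharp).hom⟩
  comm := by
    have hf := (comm_iff L _ _ _ _ _).mp f.comm
    have hg := (comm_iff L _ _ _ _ _).mp g.comm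
    rw [comm_iff]
    intro U a
    have h1 := hf (preimage g.base g.isSpectralMap U) (L.map (g.sharp.hom.app (op U)) a)
    have h2 := congrArg (preimage f.base f.isSpectralMap) (hg U a)
    refine Eq.trans ?_ (h1.trans h2)
    exact congrArg (fun k => supp L X.β (U := preimage f.base f.isSpectralMap
      (preimage g.base g.isSpectralMap U)) (k a)) (L.map_comp _ _)

instance : Category (SupportedSpace L) where
  Hom := Hom
  id := Hom.id
  comp := Hom.comp
  id_comp _ := Hom.ext rfl (heq_of_eq (Sheaf.hom_ext (Category.comp_id _)))
  comp_id _ := Hom.ext rfl (heq_of_eq (Sheaf.hom_ext (Category.id_comp _)))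
  assoc f g h := Hom.ext rfl (heq_of_eq (Sheaf.hom_ext (Category.assoc h.sharp.hom
    ((pushforward h.base h.isSpectralMap).map g.sharp).hom ((pushforward h.base h.isSpectralMap).map
      ((pushforward g.base g.isSpectralMap).map f.sharp)).hom).symm))

end SupportedSpace
end Coh
/-! ### Algebraic types -/

/-- The terms in `n` variables over the graded set `Ω` of operators, that is, the `n`-ary derived
operators generated by `Ω`. -/
inductive OpTerm (Ω : ℕ → Type u) (n : ℕ) : Type u
  | var (i : Fin n) : OpTerm Ω n
  | app {k : ℕ} (φ : Ω k) (t : Fin k → OpTerm Ω n) : OpTerm Ω n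

/-- The value of a derived operator on a set on which the operators act. -/
def OpTerm.eval {Ω : ℕ → Type u} {A : Type u} (op : ∀ {k : ℕ}, Ω k → (Fin k → A) → A) {n : ℕ}
    (x : Fin n → A) : OpTerm Ω n → A
  | .var i => x i
  | .app φ t => op φ fun i => (t i).eval op x

/-- A finitary algebraic type: a graded set of operators, with an equivalence relation on the set
of `n`-ary derived operators for each `n`. -/
structure AlgType : Type (u + 1) where
  Op : ℕ → Type u
  rel : ∀ n : ℕ, Setoid (OpTerm Op n)

namespace AlgType

/-- The structure of a `V`-algebra on a set. -/
class VAlgebra (V : AlgType.{u}) (A : Type u) where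
  op : ∀ {n : ℕ}, V.Op n → (Fin n → A) → A
  eval_eq : ∀ {n : ℕ} (s t : OpTerm V.Op n), V.rel n s t →
    ∀ x : Fin n → A, s.eval op x = t.eval op x

open AlgType.VAlgebra (op)

variable (V : AlgType.{u})

/-- Homomorphisms of `V`-algebras. -/
def IsHom {A B : Type u} [VAlgebra V A] [VAlgebra V B] (f : A → B) : Prop :=
  ∀ (n : ℕ) (φ : V.Op n) (x : Fin n → A), f (op φ x) = op φ fun i => f (x i)

/-- `V` has the self enhancing property: for any `V`-algebras `A` and `B`, the set of homomorphisms
`A → B` is a `V`-algebra under the pointwise operations, that is, it is closed under them. The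
equations of `V` and the bilinearity of the composition are then automatic. -/
def SelfEnhancing : Prop :=
  ∀ (A B : Type u) [VAlgebra V A] [VAlgebra V B] (n : ℕ) (φ : V.Op n) (f : Fin n → A → B),
    (∀ i, IsHom V (f i)) → IsHom V fun a => op φ fun i => f i a

/-- The structure of a `W`-algebra on a commutative multiplicative monoid, where `W` is the type of
commutative monoid objects in `V`-algebras: a structure of a `V`-algebra for which the
multiplication distributes over all operators. -/
class CMonAlgebra (R : Type u) [CommMonoid R] extends VAlgebra V R where
  mul_op : ∀ {n : ℕ} (a : R) (φ : V.Op n) (x : Fin n → R), a * op φ x = op φ fun i => a * x i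

end AlgType

/-- A `W`-algebra, for `W` the type of commutative monoid objects in `V`-algebras. -/
structure WAlg (V : AlgType.{u}) : Type (u + 1) where
  carrier : Type u
  [commMonoid : CommMonoid carrier]
  [alg : V.CMonAlgebra carrier]

namespace WAlg

variable {V : AlgType.{u}}

instance : CoeSort (WAlg V) (Type u) := ⟨carrier⟩

attribute [instance] commMonoid alg

open AlgType AlgType.VAlgebra

/-- A homomorphism of `W`-algebras. -/
@[ext]
structure Hom (R S : WAlg V) where
  hom : R →* S
  isHom : IsHom V hom

instance : Category (WAlg V) where
  Hom := Hom
  id R := ⟨MonoidHom.id R, fun _ _ _ => rfl⟩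
  comp f g := ⟨g.hom.comp f.hom, fun _ φ x => by
    change g.hom (f.hom _) = _
    rw [f.isHom, g.isHom]
    rfl⟩

@[ext] lemma hom_ext {R S : WAlg V} {f g : R ⟶ S} (h : ∀ x, f.hom x = g.hom x) : f = g :=
  Hom.ext (MonoidHom.ext h)

@[simp] lemma id_hom (R : WAlg V) (x : R) : Hom.hom (𝟙 R) x = x := rfl
@[simp] lemma comp_hom {R S T : WAlg V} (f : R ⟶ S) (g : S ⟶ T) (x : R) :
    (f ≫ g).hom x = g.hom (f.hom x) := rfl

/-! ### Localization -/

section Localization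

variable {R : WAlg V} (S : Submonoid R)

lemma exists_common {n : ℕ} (z : Fin n → Localization S) :
    ∃ (x : Fin n → R) (s : S), ∀ i, z i = Localization.mk (x i) s := by
  have h : ∀ i, ∃ p : R × S, z i = Localization.mk p.1 p.2 := fun i => by
    induction z i using Localization.induction_on with
    | H p => exact ⟨p, rfl⟩
  choose p hp using h
  refine ⟨fun i => ((∏ j ∈ Finset.univ.erase i, (p j).2 : S) : R) * (p i).1, ∏ j, (p j).2,
    fun i => ?_⟩
  rw [hp, Localization.mk_eq_mk_iff, Localization.r_iff_exists]
  refine ⟨1, ?_⟩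
  rw [← Finset.mul_prod_erase Finset.univ (fun j => (p j).2) (Finset.mem_univ i)]
  simp only [OneMemClass.coe_one, one_mul, Submonoid.coe_mul]
  ac_rfl

lemma op_mk_eq {n : ℕ} (φ : V.Op n) {x y : Fin n → R} {s t : S}
    (h : ∀ i, Localization.mk (x i) s = Localization.mk (y i) t) :
    Localization.mk (op φ x) s = Localization.mk (op φ y) t := by
  simp only [Localization.mk_eq_mk_iff, Localization.r_iff_exists] at h ⊢
  choose c hc using h
  refine ⟨∏ i, c i, ?_⟩
  simp only [CMonAlgebra.mul_op]
  congr 1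
  funext i
  rw [← Finset.mul_prod_erase Finset.univ c (Finset.mem_univ i), Submonoid.coe_mul,
    mul_comm (c i : R), mul_assoc, mul_assoc, hc]

/-- The operators on `S⁻¹R`: `φ (x₁ / s, …, xₙ / s) = φ (x₁, …, xₙ) / s`. -/
def locOp {n : ℕ} (φ : V.Op n) (z : Fin n → Localization S) : Localization S :=
  Localization.mk (op φ (exists_common S z).choose) (exists_common S z).choose_spec.choose

lemma locOp_mk {n : ℕ} (φ : V.Op n) (x : Fin n → R) (s : S) :
    locOp S φ (fun i => Localization.mk (x i) s) = Localization.mk (op φ x) s :=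
  (op_mk_eq S φ fun i => (exists_common S
    (fun i => Localization.mk (x i) s)).choose_spec.choose_spec i).symm

lemma eval_mk {n : ℕ} (t : OpTerm V.Op n) (x : Fin n → R) (s : S) :
    t.eval (locOp S) (fun i => Localization.mk (x i) s) = Localization.mk (t.eval op x) s := by
  induction t with
  | var i => rfl
  | app φ t ih =>
    change locOp S φ _ = Localization.mk (op φ _) s
    rw [← locOp_mk]
    exact congrArg _ (funext ih)

instance : V.CMonAlgebra (Localization S) where
  op := locOp S
  eval_eq s t h z := by
    obtain ⟨x, c, hz⟩ := exists_common S z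
    obtain rfl : z = fun i => Localization.mk (x i) c := funext hz
    rw [eval_mk, eval_mk, VAlgebra.eval_eq s t h]
  mul_op a φ z := by
    obtain ⟨x, c, hz⟩ := exists_common S z
    obtain rfl : z = fun i => Localization.mk (x i) c := funext hz
    induction a using Localization.induction_on with
    | H p =>
      simp only [Localization.mk_mul]
      change _ * locOp S φ _ = locOp S φ _
      rw [locOp_mk, locOp_mk, Localization.mk_mul, CMonAlgebra.mul_op]

/-- The localization `S⁻¹R` of a `W`-algebra. -/
def loc : WAlg V := ⟨Localization S⟩

/-- The canonical homomorphism `R → S⁻¹R`. -/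
def toLoc : R ⟶ loc S where
  hom := (Localization.monoidOf S).toMonoidHom
  isHom _ φ x := (locOp_mk S φ x 1).symm

/-- The fraction `x / s` in `S⁻¹R`. -/
def frac (x : R) (s : S) : loc S := Localization.mk x s

lemma exists_frac (z : loc S) : ∃ x s, z = frac S x s := by
  induction z using Localization.induction_on with
  | H p => exact ⟨p.1, p.2, rfl⟩

lemma toLoc_mul_frac (x : R) (s : S) : (toLoc S).hom s * frac S x s = (toLoc S).hom x := by
  change Localization.monoidOf S s * Localization.mk x s = Localization.monoidOf S x
  rw [Localization.mk_eq_monoidOf_mk']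
  exact (Localization.monoidOf S).mk'_spec' _ _

/-- `g : R → A` is a localization at `S`: it makes the elements of `S` invertible, and it is
universal with this property. -/
def IsLoc {A : WAlg V} (g : R ⟶ A) : Prop :=
  (∀ s ∈ S, IsUnit (g.hom s)) ∧
    ∀ (B : WAlg V) (h : R ⟶ B), (∀ s ∈ S, IsUnit (h.hom s)) → ∃! k : A ⟶ B, g ≫ k = h

lemma isLoc_toLoc : IsLoc S (toLoc S) := by
  refine ⟨fun s hs => (Localization.monoidOf S).map_units ⟨s, hs⟩, fun B h hh => ?_⟩
  let k : loc S →* B := (Localization.monoidOf S).lift (g := h.hom) fun s => hh s s.2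
  have hk0 : ∀ x, k ((toLoc S).hom x) = h.hom x := fun x => (Localization.monoidOf S).lift_eq _ _
  have hk : ∀ (k' : loc S →* B), (∀ x, k' ((toLoc S).hom x) = h.hom x) →
      ∀ x (s : S), h.hom s * k' (frac S x s) = h.hom x := fun k' hk' x s => by
    rw [← hk', ← map_mul, toLoc_mul_frac, hk']
  refine ⟨⟨k, fun n φ z => ?_⟩, ?_, fun k' hk' => ?_⟩
  · obtain ⟨x, c, hz⟩ := exists_common S z
    obtain rfl : z = fun i => frac S (x i) c := funext hz
    apply (hh c c.2).mul_left_cancel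
    have h1 : op φ (fun i => frac S (x i) c) = frac S (op φ x) c := locOp_mk S φ x c
    rw [h1, hk k hk0, h.isHom, CMonAlgebra.mul_op]
    exact congrArg _ (funext fun i => (hk k hk0 _ _).symm)
  · ext x
    exact hk0 x
  · ext z
    obtain ⟨x, c, rfl⟩ := exists_frac S z
    apply (hh c c.2).mul_left_cancel
    refine Eq.trans (hk k'.hom (fun x => ?_) x c) (hk k hk0 x c).symm
    rw [← hk']
    rfl

lemma IsLoc.exists_iso {A B : WAlg V} {g : R ⟶ A} {h : R ⟶ B} (hg : IsLoc S g) (hh : IsLoc S h) :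
    ∃ e : A ≅ B, g ≫ e.hom = h := by
  obtain ⟨k, hk, -⟩ := hg.2 B h hh.1
  obtain ⟨l, hl, -⟩ := hh.2 A g hg.1
  refine ⟨⟨k, l, ?_, ?_⟩, hk⟩
  · exact (hg.2 A g hg.1).unique (by rw [← Category.assoc, hk, hl]) (Category.comp_id _)
  · exact (hh.2 B h hh.1).unique (by rw [← Category.assoc, hl, hk]) (Category.comp_id _)

variable {S}

lemma IsLoc.surj {A : WAlg V} {g : R ⟶ A} (hg : IsLoc S g) (y : A) :
    ∃ s ∈ S, ∃ x, g.hom s * y = g.hom x := by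
  obtain ⟨e, he⟩ := (isLoc_toLoc S).exists_iso S hg
  obtain ⟨x, s, hp⟩ := exists_frac S (e.inv.hom y)
  refine ⟨s, s.2, x, ?_⟩
  have hy : y = e.hom.hom (frac S x s) := by
    rw [← hp, ← comp_hom, e.inv_hom_id, id_hom]
  rw [hy, ← he, comp_hom, comp_hom, ← map_mul, toLoc_mul_frac]

lemma IsLoc.eq_iff {A : WAlg V} {g : R ⟶ A} (hg : IsLoc S g) {x y : R} :
    g.hom x = g.hom y ↔ ∃ s ∈ S, s * x = s * y := by
  constructor
  · intro h
    obtain ⟨e, he⟩ := hg.exists_iso S (isLoc_toLoc S)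
    have h2 : (toLoc S).hom x = (toLoc S).hom y := by rw [← he, comp_hom, comp_hom, h]
    obtain ⟨c, hc⟩ := (Localization.monoidOf S).exists_of_eq h2
    exact ⟨c, c.2, hc⟩
  · rintro ⟨s, hs, h⟩
    apply (hg.1 s hs).mul_left_cancel
    rw [← map_mul, ← map_mul, h]

end Localization
/-! ### Ideals -/

/-- An ideal of a `W`-algebra `R`: an `R`-submodule of `R`, that is, a subset closed under the
operators of `V` and under the multiplication by elements of `R`. -/
@[ext]
structure Idl (R : WAlg V) where
  carrier : Set R
  op_mem : ∀ {n : ℕ} (φ : V.Op n) (x : Fin n → R), (∀ i, x i ∈ carrier) → op φ x ∈ carrier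
  mul_mem : ∀ (a x : R), x ∈ carrier → a * x ∈ carrier

/-- Membership in the ideal generated by a set. -/
inductive InSpan {R : WAlg V} (s : Set R) : R → Prop
  | base (x : R) (h : x ∈ s) : InSpan s x
  | op {n : ℕ} (φ : V.Op n) (x : Fin n → R) (h : ∀ i, InSpan s (x i)) : InSpan s (op φ x)
  | mul (a x : R) (h : InSpan s x) : InSpan s (a * x)

namespace Idl

variable {R : WAlg V}

instance : SetLike (Idl R) R := ⟨carrier, fun _ _ => Idl.ext⟩

instance : PartialOrder (Idl R) := .ofSetLike (Idl R) R

/-- The ideal generated by a set. -/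
def span (s : Set R) : Idl R := ⟨{x | InSpan s x}, InSpan.op, InSpan.mul⟩

lemma subset_span (s : Set R) : s ⊆ span s := fun x h => .base x h

lemma span_le {s : Set R} {I : Idl R} : span s ≤ I ↔ s ⊆ I := by
  refine ⟨fun h => (subset_span s).trans h, fun h x hx => ?_⟩
  change InSpan s x at hx
  induction hx with
  | base x hx => exact h hx
  | op φ x _ ih => exact I.op_mem φ x ih
  | mul a x _ ih => exact I.mul_mem a x ih

lemma span_mono {s t : Set R} (h : s ⊆ t) : span s ≤ span t := span_le.mpr (h.trans (subset_span t))

@[simp] lemma span_coe (I : Idl R) : span (I : Set R) = I :=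
  le_antisymm (span_le.mpr fun _ h => h) (subset_span _)

/-- The sum of two ideals: the ideal generated by the union. -/
instance : Add (Idl R) := ⟨fun I J => span (I ∪ J)⟩
/-- The product of two ideals: the ideal generated by the products of elements. -/
instance : Mul (Idl R) := ⟨fun I J => span {z | ∃ x ∈ I, ∃ y ∈ J, x * y = z}⟩
/-- The zero ideal: the ideal generated by the empty set. -/
instance : Zero (Idl R) := ⟨span ∅⟩
/-- The unit ideal. -/
instance : One (Idl R) := ⟨⟨Set.univ, fun _ _ _ => trivial, fun _ _ _ => trivial⟩⟩

lemma mem_one (x : R) : x ∈ (1 : Idl R) := trivial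

lemma le_one (I : Idl R) : I ≤ 1 := fun _ _ => trivial

lemma eq_one_iff {I : Idl R} : I = 1 ↔ (1 : R) ∈ I :=
  ⟨fun h => h ▸ mem_one 1, fun h => le_antisymm (le_one I) fun x _ => by
    simpa using! I.mul_mem x 1 h⟩

lemma span_one : span {(1 : R)} = 1 := eq_one_iff.mpr (subset_span _ rfl)

lemma add_le {I J K : Idl R} : I + J ≤ K ↔ I ≤ K ∧ J ≤ K :=
  span_le.trans Set.union_subset_iff

lemma mul_le {I J K : Idl R} : I * J ≤ K ↔ ∀ x ∈ I, ∀ y ∈ J, x * y ∈ K :=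
  span_le.trans ⟨fun h x hx y hy => h ⟨x, hx, y, hy, rfl⟩, fun h => by
    rintro _ ⟨x, hx, y, hy, rfl⟩; exact h x hx y hy⟩

lemma mul_mem_mul {I J : Idl R} {x y : R} (hx : x ∈ I) (hy : y ∈ J) : x * y ∈ I * J :=
  subset_span _ ⟨x, hx, y, hy, rfl⟩

/-- The ideal of the elements `x` such that `x * y ∈ K`. -/
def colon (K : Idl R) (y : R) : Idl R where
  carrier := {x | x * y ∈ K}
  op_mem φ x h := by
    change op φ x * y ∈ K
    rw [mul_comm, CMonAlgebra.mul_op]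
    exact K.op_mem φ _ fun i => by rw [mul_comm]; exact h i
  mul_mem a x h := by
    change a * x * y ∈ K
    rw [mul_assoc]
    exact K.mul_mem a _ h

lemma span_mul_span (s t : Set R) : span s * span t = span {z | ∃ x ∈ s, ∃ y ∈ t, x * y = z} := by
  set K := span {z | ∃ x ∈ s, ∃ y ∈ t, x * y = z}
  refine le_antisymm (mul_le.mpr fun x hx y hy => ?_) (span_le.mpr ?_)
  · have h1 : ∀ x ∈ s, span t ≤ colon K x := fun x hx => span_le.mpr fun y hy =>
      subset_span _ ⟨x, hx, y, hy, mul_comm _ _⟩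
    have h2 : span s ≤ colon K y := span_le.mpr fun x hx => by
      change x * y ∈ K
      rw [mul_comm]
      exact h1 x hx hy
    exact h2 hx
  · rintro _ ⟨x, hx, y, hy, rfl⟩
    exact mul_mem_mul (subset_span _ hx) (subset_span _ hy)

lemma span_add_span (s t : Set R) : span s + span t = span (s ∪ t) :=
  le_antisymm (add_le.mpr ⟨span_mono Set.subset_union_left, span_mono Set.subset_union_right⟩)
    (span_mono (Set.union_subset_union (subset_span s) (subset_span t)))

lemma left_le_add (I J : Idl R) : I ≤ I + J := (add_le.mp le_rfl).1
lemma right_le_add (I J : Idl R) : J ≤ I + J := (add_le.mp le_rfl).2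

lemma mul_mono {I J K T : Idl R} (h : I ≤ K) (h' : J ≤ T) : I * J ≤ K * T :=
  mul_le.mpr fun _ hx _ hy => mul_mem_mul (h hx) (h' hy)

protected lemma mul_comm (I J : Idl R) : I * J = J * I :=
  le_antisymm (mul_le.mpr fun x hx y hy => mul_comm y x ▸ mul_mem_mul hy hx)
    (mul_le.mpr fun x hx y hy => mul_comm y x ▸ mul_mem_mul hy hx)

lemma mul_le_right (I J : Idl R) : I * J ≤ J := mul_le.mpr fun x _ y hy => J.mul_mem x y hy
lemma mul_le_left (I J : Idl R) : I * J ≤ I := Idl.mul_comm I J ▸ mul_le_right J I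

/-- The semiring of ideals. -/
instance : CommSemiring (Idl R) where
  add_assoc I J K := le_antisymm
    (add_le.mpr ⟨add_le.mpr ⟨left_le_add _ _, (left_le_add _ _).trans (right_le_add _ _)⟩,
      (right_le_add _ _).trans (right_le_add _ _)⟩)
    (add_le.mpr ⟨(left_le_add _ _).trans (left_le_add _ _),
      add_le.mpr ⟨(right_le_add _ _).trans (left_le_add _ _), right_le_add _ _⟩⟩)
  zero_add I := le_antisymm (add_le.mpr ⟨span_le.mpr (Set.empty_subset _), le_rfl⟩)
    (right_le_add _ _)
  add_zero I := le_antisymm (add_le.mpr ⟨le_rfl, span_le.mpr (Set.empty_subset _)⟩)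
    (left_le_add _ _)
  add_comm I J := le_antisymm (add_le.mpr ⟨right_le_add _ _, left_le_add _ _⟩)
    (add_le.mpr ⟨right_le_add _ _, left_le_add _ _⟩)
  nsmul := nsmulRec
  left_distrib I J K := by
    refine le_antisymm ?_ (add_le.mpr ⟨mul_mono le_rfl (left_le_add _ _),
      mul_mono le_rfl (right_le_add _ _)⟩)
    conv_lhs => rw [← span_coe I, ← span_coe J, ← span_coe K, span_add_span, span_mul_span]
    refine span_le.mpr ?_
    rintro _ ⟨x, hx, y, hy | hy, rfl⟩
    · exact left_le_add _ _ (mul_mem_mul hx hy)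
    · exact right_le_add _ _ (mul_mem_mul hx hy)
  right_distrib I J K := by
    refine le_antisymm ?_ (add_le.mpr ⟨mul_mono (left_le_add _ _) le_rfl,
      mul_mono (right_le_add _ _) le_rfl⟩)
    conv_lhs => rw [← span_coe I, ← span_coe J, ← span_coe K, span_add_span, span_mul_span]
    refine span_le.mpr ?_
    rintro _ ⟨x, hx | hx, y, hy, rfl⟩
    · exact left_le_add _ _ (mul_mem_mul hx hy)
    · exact right_le_add _ _ (mul_mem_mul hx hy)
  zero_mul I := le_antisymm (mul_le_left _ _) (span_le.mpr (Set.empty_subset _))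
  mul_zero I := le_antisymm (mul_le_right _ _) (span_le.mpr (Set.empty_subset _))
  mul_assoc I J K := by
    rw [← span_coe I, ← span_coe J, ← span_coe K]
    simp only [span_mul_span]
    congr 1
    ext z
    constructor
    · rintro ⟨_, ⟨x, hx, y, hy, rfl⟩, w, hw, rfl⟩
      exact ⟨x, hx, _, ⟨y, hy, w, hw, rfl⟩, (mul_assoc _ _ _).symm⟩
    · rintro ⟨x, hx, _, ⟨y, hy, w, hw, rfl⟩, rfl⟩
      exact ⟨_, ⟨x, hx, y, hy, rfl⟩, w, hw, mul_assoc _ _ _⟩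
  one_mul I := le_antisymm (mul_le_right _ _) fun x hx => by
    simpa using! mul_mem_mul (mem_one (1 : R)) hx
  mul_one I := le_antisymm (mul_le_left _ _) fun x hx => by
    simpa using! mul_mem_mul hx (mem_one (1 : R))
  mul_comm := Idl.mul_comm

lemma pow_mono {I J : Idl R} (h : I ≤ J) (n : ℕ) : I ^ n ≤ J ^ n := by
  induction n with
  | zero => simp
  | succ n ih => rw [pow_succ, pow_succ]; exact mul_mono ih h

lemma pow_anti (I : Idl R) {m n : ℕ} (h : m ≤ n) : I ^ n ≤ I ^ m := by
  obtain ⟨k, rfl⟩ := Nat.exists_eq_add_of_le h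
  rw [pow_add]; exact mul_le_left _ _

lemma pow_add_le {I J K : Idl R} {m n : ℕ} (h : I ^ m ≤ K) (h' : J ^ n ≤ K) :
    (I + J) ^ (m + n) ≤ K := by
  have hs : ∀ (t : Finset ℕ) (f : ℕ → Idl R), (∀ i ∈ t, f i ≤ K) → ∑ i ∈ t, f i ≤ K := by
    intro t f
    induction t using Finset.cons_induction with
    | empty => exact fun _ => span_le.mpr (Set.empty_subset _)
    | cons a t ha ih =>
      intro h
      rw [Finset.sum_cons]
      exact add_le.mpr ⟨h a (Finset.mem_cons_self a t), ih fun i hi =>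
        h i (Finset.mem_cons_of_mem hi)⟩
  rw [add_pow]
  refine hs _ _ fun i _ => (mul_le_left _ _).trans ?_
  rcases le_total m i with hi | hi
  · exact (mul_le_left _ _).trans ((pow_anti I hi).trans h)
  · exact (mul_le_right _ _).trans ((pow_anti J (by omega)).trans h')

/-- Finitely generated ideals. -/
def FG (I : Idl R) : Prop := ∃ s : Set R, s.Finite ∧ span s = I

lemma FG.add {I J : Idl R} : I.FG → J.FG → (I + J).FG := by
  rintro ⟨s, hs, rfl⟩ ⟨t, ht, rfl⟩
  exact ⟨s ∪ t, hs.union ht, (span_add_span s t).symm⟩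

lemma FG.mul {I J : Idl R} : I.FG → J.FG → (I * J).FG := by
  rintro ⟨s, hs, rfl⟩ ⟨t, ht, rfl⟩
  exact ⟨_, Set.Finite.image2 (· * ·) hs ht, (span_mul_span s t).symm⟩

lemma pow_span_le {s : Set R} (hs : s.Finite) {J : Idl R} (h : ∀ x ∈ s, ∃ n : ℕ, x ^ n ∈ J) :
    ∃ n, span s ^ n ≤ J := by
  induction s, hs using Set.Finite.induction_on with
  | empty => exact ⟨1, by rw [pow_one]; exact span_le.mpr (Set.empty_subset _)⟩
  | @insert a s _ _ ih =>
    obtain ⟨n, hn⟩ := ih fun x hx => h x (Set.mem_insert_of_mem a hx)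
    obtain ⟨m, hm⟩ := h a (Set.mem_insert a s)
    refine ⟨m + n, ?_⟩
    rw [Set.insert_eq, ← span_add_span]
    refine pow_add_le ?_ hn
    have : ∀ k : ℕ, span {a} ^ k = span {a ^ k} := fun k => by
      induction k with
      | zero => rw [pow_zero, pow_zero, span_one]
      | succ k ih => rw [pow_succ, pow_succ, ih, span_mul_span]; congr 1; ext; simp [eq_comm]
    rw [this]
    exact span_le.mpr (by simpa using hm)

/-- The ideal of `S` generated by the image of an ideal of `R`. -/
def map {R S : WAlg V} (f : R ⟶ S) (I : Idl R) : Idl S := span (f.hom '' I)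

/-- The inverse image of an ideal. -/
def comap {R S : WAlg V} (f : R ⟶ S) (J : Idl S) : Idl R where
  carrier := {x | f.hom x ∈ J}
  op_mem φ x h := by
    change f.hom (op φ x) ∈ J
    rw [f.isHom]; exact J.op_mem φ _ h
  mul_mem a x h := by
    change f.hom (a * x) ∈ J
    rw [map_mul]; exact J.mul_mem _ _ h

lemma map_span {R S : WAlg V} (f : R ⟶ S) (s : Set R) : map f (span s) = span (f.hom '' s) := by
  refine le_antisymm (span_le.mpr ?_) (span_mono (Set.image_mono (subset_span s)))
  rintro _ ⟨x, hx, rfl⟩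
  exact (span_le (I := comap f (span (f.hom '' s)))).mpr
    (fun x hx => subset_span _ ⟨x, hx, rfl⟩) hx

section
variable {R S : WAlg V} (f : R ⟶ S)

lemma map_mono {I J : Idl R} (h : I ≤ J) : map f I ≤ map f J := span_mono (Set.image_mono h)

lemma map_add (I J : Idl R) : map f (I + J) = map f I + map f J := by
  conv_lhs => rw [← span_coe I, ← span_coe J, span_add_span, map_span, Set.image_union]
  rw [map, map, span_add_span]

lemma map_mul' (I J : Idl R) : map f (I * J) = map f I * map f J := by
  conv_lhs => rw [← span_coe I, ← span_coe J, span_mul_span, map_span]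
  rw [map, map, span_mul_span]
  congr 1
  ext z
  constructor
  · rintro ⟨_, ⟨x, hx, y, hy, rfl⟩, rfl⟩
    exact ⟨_, ⟨x, hx, rfl⟩, _, ⟨y, hy, rfl⟩, (map_mul _ _ _).symm⟩
  · rintro ⟨_, ⟨x, hx, rfl⟩, _, ⟨y, hy, rfl⟩, rfl⟩
    exact ⟨_, ⟨x, hx, y, hy, rfl⟩, map_mul _ _ _⟩

lemma map_one' : map f (1 : Idl R) = 1 := by
  rw [← span_one, map_span, Set.image_singleton, map_one, span_one]

lemma map_pow' (I : Idl R) (n : ℕ) : map f (I ^ n) = map f I ^ n := by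
  induction n with
  | zero => simp [map_one']
  | succ n ih => rw [pow_succ, pow_succ, map_mul', ih]

lemma map_zero' : map f (0 : Idl R) = 0 :=
  (map_span f ∅).trans (by rw [Set.image_empty]; rfl)

lemma map_comp {T : WAlg V} (g : S ⟶ T) (I : Idl R) : map (f ≫ g) I = map g (map f I) := by
  conv_rhs => rw [map, map, ← map, map_span, ← Set.image_comp]
  rfl

lemma FG.map {I : Idl R} : I.FG → (map f I).FG := by
  rintro ⟨s, hs, rfl⟩
  exact ⟨_, hs.image _, (map_span f s).symm⟩

end

end Idl
/-! ### The lattice of finitely generated ideals modulo radical equivalence -/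

/-- Radical equivalence of finitely generated ideals: `𝔞ⁿ ≤ 𝔟` and `𝔟ⁿ ≤ 𝔞` for `n ≫ 0`. -/
def radSetoid (R : WAlg V) : Setoid {I : Idl R // I.FG} where
  r I J := ∀ᶠ n : ℕ in Filter.atTop, I.1 ^ n ≤ J.1 ∧ J.1 ^ n ≤ I.1
  iseqv :=
    { refl := fun I => Filter.eventually_atTop.mpr ⟨1, fun n hn => by
        have := Idl.pow_anti I.1 hn
        rw [pow_one] at this
        exact ⟨this, this⟩⟩
      symm := fun h => h.mono fun _ hn => hn.symm
      trans := fun {I J K} h h' => by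
        obtain ⟨m, hm⟩ := h.exists
        obtain ⟨k, hk⟩ := h'.exists
        refine Filter.eventually_atTop.mpr ⟨m * k, fun n hn => ⟨?_, ?_⟩⟩
        · refine (Idl.pow_anti _ hn).trans ?_
          rw [pow_mul]
          exact (Idl.pow_mono hm.1 k).trans hk.1
        · refine (Idl.pow_anti _ hn).trans ?_
          rw [mul_comm, pow_mul]
          exact (Idl.pow_mono hk.2 m).trans hm.2 }

/-- The set `α₁(R)` of finitely generated ideals of `R` modulo radical equivalence. -/
def RadIdl (R : WAlg V) : Type u := Quotient (radSetoid R)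

namespace RadIdl

variable {R : WAlg V}

/-- The class of a finitely generated ideal. -/
def mk (I : Idl R) (h : I.FG) : RadIdl R := Quotient.mk _ ⟨I, h⟩

lemma ind {p : RadIdl R → Prop} (h : ∀ I hI, p (mk I hI)) (x : RadIdl R) : p x :=
  Quotient.ind (fun I => h I.1 I.2) x

lemma mk_eq_iff {I J : Idl R} {hI : I.FG} {hJ : J.FG} :
    mk I hI = mk J hJ ↔ (∃ n, I ^ n ≤ J) ∧ ∃ n, J ^ n ≤ I := by
  refine Quotient.eq.trans ⟨fun h => ?_, fun ⟨⟨m, hm⟩, ⟨k, hk⟩⟩ => ?_⟩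
  · obtain ⟨n, h1, h2⟩ := Filter.Eventually.exists h
    exact ⟨⟨n, h1⟩, ⟨n, h2⟩⟩
  · exact Filter.eventually_atTop.mpr ⟨m + k, fun n hn =>
      ⟨(Idl.pow_anti _ (by omega)).trans hm, (Idl.pow_anti _ (by omega)).trans hk⟩⟩

/-- The join, induced by the sum of ideals. -/
instance : Max (RadIdl R) := ⟨Quotient.map₂ (fun I J => ⟨I.1 + J.1, I.2.add J.2⟩) (by
  intro I I' h J J' h'
  have h := mk_eq_iff.mp (Quotient.sound h)
  have h' := mk_eq_iff.mp (Quotient.sound h')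
  obtain ⟨⟨m, hm⟩, ⟨n, hn⟩⟩ := h
  obtain ⟨⟨k, hk⟩, ⟨l, hl⟩⟩ := h'
  exact Quotient.exact (mk_eq_iff.mpr
    ⟨⟨_, Idl.pow_add_le (hm.trans (Idl.left_le_add _ _)) (hk.trans (Idl.right_le_add _ _))⟩,
      ⟨_, Idl.pow_add_le (hn.trans (Idl.left_le_add _ _)) (hl.trans (Idl.right_le_add _ _))⟩⟩))⟩

/-- The meet, induced by the product of ideals. -/
instance : Min (RadIdl R) := ⟨Quotient.map₂ (fun I J => ⟨I.1 * J.1, I.2.mul J.2⟩) (by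
  intro I I' h J J' h'
  have h := mk_eq_iff.mp (Quotient.sound h)
  have h' := mk_eq_iff.mp (Quotient.sound h')
  obtain ⟨⟨m, hm⟩, ⟨n, hn⟩⟩ := h
  obtain ⟨⟨k, hk⟩, ⟨l, hl⟩⟩ := h'
  refine Quotient.exact (mk_eq_iff.mpr ⟨⟨m + k, ?_⟩, ⟨n + l, ?_⟩⟩)
  · rw [mul_pow]
    exact Idl.mul_mono ((Idl.pow_anti _ (by omega)).trans hm)
      ((Idl.pow_anti _ (by omega)).trans hk)
  · rw [mul_pow]
    exact Idl.mul_mono ((Idl.pow_anti _ (by omega)).trans hn)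
      ((Idl.pow_anti _ (by omega)).trans hl))⟩

lemma mk_sup {I J : Idl R} (hI : I.FG) (hJ : J.FG) :
    mk I hI ⊔ mk J hJ = mk (I + J) (hI.add hJ) := rfl

lemma mk_inf {I J : Idl R} (hI : I.FG) (hJ : J.FG) :
    mk I hI ⊓ mk J hJ = mk (I * J) (hI.mul hJ) := rfl

lemma sup_eq_iff {I J : Idl R} {hI : I.FG} {hJ : J.FG} :
    mk I hI ⊔ mk J hJ = mk J hJ ↔ ∃ n, I ^ n ≤ J := by
  refine mk_eq_iff.trans ⟨fun ⟨⟨n, h⟩, _⟩ => ⟨n, (Idl.pow_mono (Idl.left_le_add I J) n).trans h⟩,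
    fun ⟨n, h⟩ => ⟨⟨n + 1, Idl.pow_add_le h (by rw [pow_one])⟩, ⟨1, ?_⟩⟩⟩
  rw [pow_one]; exact Idl.right_le_add _ _

instance : PartialOrder (RadIdl R) where
  le x y := x ⊔ y = y
  le_refl := ind fun I hI => sup_eq_iff.mpr ⟨1, by rw [pow_one]⟩
  le_trans := ind fun I hI => ind fun J hJ => ind fun K hK h h' => by
    obtain ⟨m, hm⟩ := sup_eq_iff.mp h
    obtain ⟨n, hn⟩ := sup_eq_iff.mp h'
    exact sup_eq_iff.mpr ⟨m * n, by rw [pow_mul]; exact (Idl.pow_mono hm n).trans hn⟩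
  le_antisymm := ind fun I hI => ind fun J hJ h h' =>
    mk_eq_iff.mpr ⟨sup_eq_iff.mp h, sup_eq_iff.mp h'⟩

lemma mk_le_iff {I J : Idl R} {hI : I.FG} {hJ : J.FG} :
    mk I hI ≤ mk J hJ ↔ ∃ n, I ^ n ≤ J := sup_eq_iff

instance : Lattice (RadIdl R) where
  sup x y := x ⊔ y
  inf x y := x ⊓ y
  le_sup_left := ind fun I hI => ind fun J hJ => mk_le_iff.mpr ⟨1, by
    rw [pow_one]; exact Idl.left_le_add _ _⟩
  le_sup_right := ind fun I hI => ind fun J hJ => mk_le_iff.mpr ⟨1, by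
    rw [pow_one]; exact Idl.right_le_add _ _⟩
  sup_le := ind fun I hI => ind fun J hJ => ind fun K hK h h' => by
    obtain ⟨m, hm⟩ := mk_le_iff.mp h
    obtain ⟨n, hn⟩ := mk_le_iff.mp h'
    exact mk_le_iff.mpr ⟨_, Idl.pow_add_le hm hn⟩
  inf_le_left := ind fun I hI => ind fun J hJ => mk_le_iff.mpr ⟨1, by
    rw [pow_one]; exact Idl.mul_le_left _ _⟩
  inf_le_right := ind fun I hI => ind fun J hJ => mk_le_iff.mpr ⟨1, by
    rw [pow_one]; exact Idl.mul_le_right _ _⟩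
  le_inf := ind fun I hI => ind fun J hJ => ind fun K hK h h' => by
    obtain ⟨m, hm⟩ := mk_le_iff.mp h
    obtain ⟨n, hn⟩ := mk_le_iff.mp h'
    exact mk_le_iff.mpr ⟨m + n, by rw [pow_add]; exact Idl.mul_mono hm hn⟩

instance : DistribLattice (RadIdl R) :=
  DistribLattice.ofInfSupLe <| ind fun I hI => ind fun J hJ => ind fun K hK =>
    mk_le_iff.mpr ⟨1, by rw [pow_one, mul_add]⟩

lemma fg_zero : (0 : Idl R).FG := ⟨∅, Set.finite_empty, rfl⟩
lemma fg_principal (a : R) : (Idl.span {a}).FG := ⟨{a}, Set.finite_singleton a, rfl⟩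
lemma fg_one : (1 : Idl R).FG := ⟨{1}, Set.finite_singleton 1, Idl.span_one⟩

instance : BoundedOrder (RadIdl R) where
  top := mk 1 fg_one
  bot := mk 0 fg_zero
  le_top := ind fun I hI => mk_le_iff.mpr ⟨1, Idl.le_one _⟩
  bot_le := ind fun I hI => mk_le_iff.mpr ⟨1, by
    rw [pow_one]; exact Idl.span_le.mpr (Set.empty_subset _)⟩

/-- The class of the principal ideal generated by an element. -/
def principal (a : R) : RadIdl R := mk (Idl.span {a}) (fg_principal a)

lemma principal_mul (a b : R) : principal (a * b) = principal a ⊓ principal b := by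
  change mk _ _ = mk (Idl.span {a} * Idl.span {b}) _
  congr 1
  rw [Idl.span_mul_span]
  congr 1
  ext; simp [eq_comm]

lemma principal_one : principal (1 : R) = ⊤ := by
  change mk _ _ = mk _ _
  congr 1
  exact Idl.span_one

/-- The homomorphism of lattices induced by a homomorphism of `W`-algebras. -/
def map {S : WAlg V} (f : R ⟶ S) : BoundedLatticeHom (RadIdl R) (RadIdl S) where
  toFun := Quotient.map (fun I => ⟨Idl.map f I.1, Idl.FG.map f I.2⟩) (by
    intro I J h
    obtain ⟨⟨m, hm⟩, ⟨n, hn⟩⟩ := mk_eq_iff.mp (Quotient.sound h)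
    refine Quotient.exact (mk_eq_iff.mpr ⟨⟨m, ?_⟩, ⟨n, ?_⟩⟩)
    · rw [← Idl.map_pow']; exact Idl.map_mono f hm
    · rw [← Idl.map_pow']; exact Idl.map_mono f hn)
  map_sup' := ind fun I hI => ind fun J hJ => by
    change mk _ _ = mk _ _
    congr 1; exact Idl.map_add f I J
  map_inf' := ind fun I hI => ind fun J hJ => by
    change mk _ _ = mk _ _
    congr 1; exact Idl.map_mul' f I J
  map_top' := by
    change mk _ _ = mk _ _
    congr 1; exact Idl.map_one' f
  map_bot' := by
    change mk _ _ = mk _ _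
    congr 1; exact Idl.map_zero' f

lemma map_mk {S : WAlg V} (f : R ⟶ S) (I : Idl R) (hI : I.FG) :
    map f (mk I hI) = mk (Idl.map f I) (Idl.FG.map f hI) := rfl

lemma map_principal {S : WAlg V} (f : R ⟶ S) (a : R) :
    map f (principal a) = principal (f.hom a) := by
  rw [principal, map_mk, principal]
  congr 1
  rw [Idl.map_span, Set.image_singleton]

end RadIdl

variable (V) in
/-- The functor `α₁` from `W`-algebras to distributive lattices. -/
def radFunctor : WAlg V ⥤ BddDistLat.{u} where
  obj R := BddDistLat.of (RadIdl R)
  map f := BddDistLat.ofHom (RadIdl.map f)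
  map_id R := by
    ext x
    induction x using RadIdl.ind with
    | h I hI =>
      change RadIdl.mk _ _ = RadIdl.mk _ _
      congr 1
      rw [Idl.map]
      exact (congrArg Idl.span (Set.image_id (I : Set R))).trans (Idl.span_coe I)
  map_comp f g := by
    ext x
    induction x using RadIdl.ind with
    | h I hI =>
      change RadIdl.mk _ _ = RadIdl.mk _ _
      congr 1
      exact Idl.map_comp f g I
/-! ### Schematizable algebraic types and `𝒜`-schemes -/

section
variable {R A : WAlg V} {S : Submonoid R} {g : R ⟶ A}

lemma IsLoc.mem_map (hg : IsLoc S g) (J : Idl R) {y : A} (hy : y ∈ Idl.map g J) :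
    ∃ s ∈ S, ∃ x ∈ J, g.hom s * y = g.hom x := by
  change InSpan _ y at hy
  induction hy with
  | base y h =>
    obtain ⟨x, hx, rfl⟩ := h
    exact ⟨1, S.one_mem, x, hx, by rw [map_one, one_mul]⟩
  | @op n φ y _ ih =>
    choose s hs x hx h using ih
    refine ⟨∏ i, s i, S.prod_mem fun i _ => hs i,
      op φ fun i => (∏ j ∈ Finset.univ.erase i, s j) * x i,
      J.op_mem φ _ fun i => J.mul_mem _ _ (hx i), ?_⟩
    rw [CMonAlgebra.mul_op, g.isHom]
    congr 1
    funext i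
    rw [map_mul, ← h, ← Finset.mul_prod_erase Finset.univ s (Finset.mem_univ i), map_mul]
    ac_rfl
  | mul a y _ ih =>
    obtain ⟨s, hs, x, hx, h⟩ := ih
    obtain ⟨t, ht, b, hb⟩ := hg.surj a
    refine ⟨t * s, S.mul_mem ht hs, b * x, J.mul_mem _ _ hx, ?_⟩
    rw [map_mul, map_mul, ← h, ← hb]
    ac_rfl

lemma IsLoc.of_mem_map (hg : IsLoc S g) (J : Idl R) {x : R} (hx : g.hom x ∈ Idl.map g J) :
    ∃ s ∈ S, s * x ∈ J := by
  obtain ⟨s, hs, y, hy, h⟩ := hg.mem_map J hx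
  rw [← map_mul, hg.eq_iff] at h
  obtain ⟨t, ht, h⟩ := h
  exact ⟨t * s, S.mul_mem ht hs, by rw [mul_assoc, h]; exact J.mul_mem _ _ hy⟩

lemma IsLoc.le_of_map_le (hg : IsLoc S g) {I J : Idl R} (hI : I.FG)
    (h : Idl.map g I ≤ Idl.map g J) : ∃ s ∈ S, I * Idl.span {s} ≤ J := by
  obtain ⟨T, hT, rfl⟩ := hI
  induction T, hT using Set.Finite.induction_on with
  | empty => exact ⟨1, S.one_mem, (Idl.mul_le_left _ _).trans
      (Idl.span_le.mpr (Set.empty_subset _))⟩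
  | @insert a T _ _ ih =>
    obtain ⟨s, hs, h1⟩ := ih ((Idl.map_mono g (Idl.span_mono (Set.subset_insert a T))).trans h)
    obtain ⟨t, ht, h2⟩ := hg.of_mem_map J (x := a)
      (h (Idl.subset_span _ ⟨a, Idl.subset_span _ (Set.mem_insert a T), rfl⟩))
    refine ⟨s * t, S.mul_mem hs ht, ?_⟩
    rw [Set.insert_eq, ← Idl.span_add_span, add_mul]
    refine Idl.add_le.mpr ⟨?_, (Idl.mul_mono le_rfl ?_).trans h1⟩
    · rw [Idl.span_mul_span]
      refine Idl.span_le.mpr ?_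
      rintro _ ⟨_, rfl, _, rfl, rfl⟩
      rw [mul_left_comm, mul_comm _ t]
      exact J.mul_mem _ _ h2
    · refine Idl.span_le.mpr ?_
      rintro _ rfl
      change s * t ∈ Idl.span {s}
      rw [mul_comm]
      exact (Idl.span {s}).mul_mem _ _ (Idl.subset_span _ rfl)

lemma RadIdl.map_surjective (hg : IsLoc S g) : Function.Surjective (RadIdl.map g) := by
  refine RadIdl.ind ?_
  rintro _ ⟨T, hT, rfl⟩
  choose s hs x hx using hg.surj
  have hF : (Idl.span (x '' T)).FG := ⟨_, hT.image x, rfl⟩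
  refine ⟨RadIdl.mk (Idl.span (x '' T)) hF, ?_⟩
  rw [RadIdl.map_mk]
  congr 1
  rw [Idl.map_span, ← Set.image_comp]
  refine le_antisymm (Idl.span_le.mpr ?_) (Idl.span_le.mpr fun y hy => ?_)
  · rintro _ ⟨y, hy, rfl⟩
    change g.hom (x y) ∈ _
    rw [← hx]
    exact (Idl.span T).mul_mem _ _ (Idl.subset_span _ hy)
  · obtain ⟨c, hc⟩ := (hg.1 _ (hs y)).exists_left_inv
    have : y = c * g.hom (x y) := by rw [← hx, ← mul_assoc, hc, one_mul]
    rw [this]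
    exact Idl.mul_mem _ _ _ (Idl.subset_span _ ⟨y, hy, rfl⟩)

lemma RadIdl.map_le_iff (hg : IsLoc S g) (a b : RadIdl R) :
    RadIdl.map g a ≤ RadIdl.map g b ↔ ∃ s ∈ S, a ⊓ RadIdl.principal s ≤ b := by
  induction a using RadIdl.ind with
  | h I hI =>
  induction b using RadIdl.ind with
  | h J hJ =>
  rw [RadIdl.map_mk, RadIdl.map_mk, RadIdl.mk_le_iff]
  constructor
  · rintro ⟨n, h⟩
    rw [← Idl.map_pow'] at h
    have hn : ∀ n, (I ^ n).FG := fun n => by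
      induction n with
      | zero => rw [pow_zero]; exact RadIdl.fg_one
      | succ n ih => rw [pow_succ]; exact ih.mul hI
    obtain ⟨s, hs, h⟩ := hg.le_of_map_le (hn n) h
    refine ⟨s, hs, RadIdl.mk_le_iff (hI := hI.mul (RadIdl.fg_principal s)).mpr ⟨n + 1, ?_⟩⟩
    rw [mul_pow]
    refine (Idl.mul_mono (Idl.pow_anti I (Nat.le_succ n)) ?_).trans h
    refine (Idl.pow_anti _ (Nat.succ_le_succ (Nat.zero_le n))).trans ?_
    rw [pow_one]
  · rintro ⟨s, hs, h⟩
    obtain ⟨n, h⟩ := RadIdl.mk_le_iff (hI := hI.mul (RadIdl.fg_principal s)).mp h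
    refine ⟨n, ?_⟩
    have h := Idl.map_mono g h
    rw [Idl.map_pow', Idl.map_mul', Idl.map_span, Set.image_singleton] at h
    have h1 : Idl.span {g.hom s} = 1 := by
      rw [Idl.eq_one_iff]
      obtain ⟨c, hc⟩ := (hg.1 s hs).exists_left_inv
      rw [← hc]
      exact Idl.mul_mem _ _ _ (Idl.subset_span _ rfl)
    rwa [h1, mul_one] at h

end

variable (V) in
/-- A schematizable algebraic type `(W, α₁, α₂, γ)`, where `W` is the type of commutative monoid
objects in `V`-algebras. The datum `γ` is a natural isomorphism, under `α₁(R)`, between `α₁(S⁻¹R)`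
and the localization of `α₁(R)` at `α₂(S)`; the latter is the quotient of `α₁(R)` in which `a` and
`b` are identified when `a ⊓ α₂(s) = b ⊓ α₂(s)` for some `s ∈ S`, so that there is at most one such
isomorphism, and it exists if and only if `α₁(R) → α₁(S⁻¹R)` is surjective and makes exactly these
identifications. -/
structure SchematizableType where
  α₁ : WAlg V ⥤ BddDistLat.{u}
  α₂ : ∀ R : WAlg V, R → α₁.obj R
  α₂_naturality : ∀ {R S : WAlg V} (f : R ⟶ S) (a : R), α₂ S (f.hom a) = α₁.map f (α₂ R a)
  α₂_one : ∀ R : WAlg V, α₂ R 1 = ⊤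
  α₂_mul : ∀ (R : WAlg V) (a b : R), α₂ R (a * b) = α₂ R a ⊓ α₂ R b
  γ_surjective : ∀ (R : WAlg V) (S : Submonoid R), Function.Surjective (α₁.map (toLoc S))
  γ_eq_iff : ∀ (R : WAlg V) (S : Submonoid R) (a b : α₁.obj R),
    α₁.map (toLoc S) a = α₁.map (toLoc S) b ↔ ∃ s ∈ S, a ⊓ α₂ R s = b ⊓ α₂ R s

variable (V) in
/-- The schematizable algebraic type attached to `V`: the lattice `α₁(R)` consists of the finitely
generated ideals of `R` modulo radical equivalence, and `α₂` sends an element to the principal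
ideal that it generates. -/
def idealType : SchematizableType V where
  α₁ := radFunctor V
  α₂ _ a := RadIdl.principal a
  α₂_naturality f a := (RadIdl.map_principal f a).symm
  α₂_one _ := RadIdl.principal_one
  α₂_mul _ := RadIdl.principal_mul
  γ_surjective _ S := RadIdl.map_surjective (isLoc_toLoc S)
  γ_eq_iff R S a b := by
    change RadIdl.map (toLoc S) a = RadIdl.map (toLoc S) b ↔
      ∃ s ∈ S, (a ⊓ RadIdl.principal s : RadIdl R) = b ⊓ RadIdl.principal s
    have h := RadIdl.map_le_iff (isLoc_toLoc S)
    constructor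
    · intro h1
      obtain ⟨s, hs, h2⟩ := (h a b).mp h1.le
      obtain ⟨t, ht, h3⟩ := (h b a).mp h1.ge
      refine ⟨s * t, S.mul_mem hs ht, ?_⟩
      rw [RadIdl.principal_mul]
      refine le_antisymm (le_inf ?_ inf_le_right) (le_inf ?_ inf_le_right)
      · exact (inf_le_inf_left a inf_le_left).trans h2
      · exact (inf_le_inf_left b inf_le_right).trans h3
    · rintro ⟨s, hs, h1⟩
      exact le_antisymm ((h a b).mpr ⟨s, hs, h1.le.trans inf_le_left⟩)
        ((h b a).mpr ⟨s, hs, h1.ge.trans inf_le_left⟩)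

end WAlg

namespace Coh

variable {D : Type (u + 1)} [Category.{u} D] {L : D ⥤ BddDistLat.{u}}

lemma SupportedSpace.support_top (X : SupportedSpace L) (U : CompactOpens X.carrier) :
    X.support (U := U) ⊤ = U := by
  have h : (X.β.hom.app (op U)) ((toLatticeSheaf L X.O).app (op U) ⊤) = ⊤ :=
    (congrArg _ (map_top ((toLatticeSheaf L X.O).app (op U)).hom)).trans
      (map_top (X.β.hom.app (op U)).hom)
  exact congrArg Subtype.val h

lemma SupportedSpace.support_inf (X : SupportedSpace L) {U : CompactOpens X.carrier}
    (a b : L.obj (X.O.obj.obj (op U))) : X.support (a ⊓ b) = X.support a ⊓ X.support b := by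
  have h := (congrArg (X.β.hom.app (op U))
    (((toLatticeSheaf L X.O).app (op U)).hom.map_inf' a b)).trans
      ((X.β.hom.app (op U)).hom.map_inf' _ _)
  exact congrArg Subtype.val h

end Coh

open Coh

namespace WAlg

variable {V : AlgType.{u}} (𝒜 : SchematizableType V)

/-- For quasi-compact open subsets `T ⊆ U`, the multiplicative system of the elements `f` of
`O_X(U)` with `β_X(α₂(f)) ≥ T`. -/
def supportSystem (X : SupportedSpace 𝒜.α₁) {T U : CompactOpens X.carrier} (h : T ≤ U) :
    Submonoid (X.O.obj.obj (op U)) where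
  carrier := {f | T ≤ X.support (U := U) (𝒜.α₂ _ f)}
  one_mem' := by
    change T ≤ X.support _
    rw [𝒜.α₂_one, X.support_top]
    exact h
  mul_mem' {a b} ha hb := by
    change T ≤ X.support _
    rw [𝒜.α₂_mul, X.support_inf]
    exact le_inf ha hb

/-- The restriction maps reflect localizations: for quasi-compact open subsets `T ⊆ U`, the
restriction map `O_X(U) → O_X(T)` factors through the localization `O_X(U)_T` of `O_X(U)` by the
multiplicative system of the elements `f` with `β_X(α₂(f)) ≥ T`. -/
def IsAScheme : ObjectProperty (SupportedSpace 𝒜.α₁) := fun X =>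
  ∀ (T U : CompactOpens X.carrier) (h : T ≤ U),
    ∃ k : loc (supportSystem 𝒜 X h) ⟶ X.O.obj.obj (op T),
      toLoc (supportSystem 𝒜 X h) ≫ k = X.O.obj.map (homOfLE h).op

/-- The category of `𝒜`-schemes. -/
abbrev AScheme : Type (u + 1) := (IsAScheme 𝒜).FullSubcategory

end WAlg
/-! ### Coherent Grothendieck topologies and the lattice `Ω₁` -/
namespace CohSite

variable {C : Type (u + 1)} [Category.{u} C]

/-- An `ℰ`-morphism with target `X`. -/
structure EOver (E : MorphismProperty C) (X : C) where
  left : C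
  hom : left ⟶ X
  prop : E hom

namespace EOver

variable {E : MorphismProperty C}

/-- `h` factors through the `ℰ`-morphism `V → X`. -/
def Fac {A X : C} (h : A ⟶ X) (V : EOver E X) : Prop := ∃ m : A ⟶ V.left, m ≫ V.hom = h

lemma fac_self {X : C} (V : EOver E X) : Fac V.hom V := ⟨𝟙 _, Category.id_comp _⟩

lemma Fac.comp {A B X : C} {h : A ⟶ X} {V : EOver E X} (H : Fac h V) (k : B ⟶ A) :
    Fac (k ≫ h) V := by
  obtain ⟨m, rfl⟩ := H
  exact ⟨k ≫ m, Category.assoc _ _ _⟩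

/-- The `ℰ`-morphism `id : X → X`. -/
def refl [E.ContainsIdentities] (X : C) : EOver E X := ⟨X, 𝟙 X, E.id_mem X⟩

lemma fac_refl [E.ContainsIdentities] {A X : C} (h : A ⟶ X) : Fac h (refl (E := E) X) :=
  ⟨h, Category.comp_id h⟩

variable [E.IsStableUnderBaseChange] [E.HasPullbacks]

/-- The base change `X ×_Y U → X` of an `ℰ`-morphism `U → Y` along `f : X → Y`. -/
def pull {X Y : C} (f : X ⟶ Y) (U : EOver E Y) : EOver E X :=
  haveI := E.hasPullback f U.prop
  ⟨Limits.pullback U.hom f, Limits.pullback.snd U.hom f, E.pullback_snd U.hom f U.prop⟩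

lemma pull_isPullback {X Y : C} (f : X ⟶ Y) (U : EOver E Y) :
    ∃ q : (pull f U).left ⟶ U.left, IsPullback q (pull f U).hom U.hom f :=
  haveI := E.hasPullback f U.prop
  ⟨_, IsPullback.of_hasPullback U.hom f⟩

lemma fac_pull_iff {A X Y : C} (h : A ⟶ X) (f : X ⟶ Y) (V : EOver E Y) :
    Fac h (pull f V) ↔ Fac (h ≫ f) V := by
  obtain ⟨q, hq⟩ := pull_isPullback f V
  constructor
  · rintro ⟨m, rfl⟩
    exact ⟨m ≫ q, by rw [Category.assoc, Category.assoc, hq.w]⟩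
  · rintro ⟨m, hm⟩
    exact ⟨hq.lift m h hm, hq.lift_snd _ _ _⟩

/-- The `ℰ`-morphism `U ×_X V → X`. -/
def meet [E.IsStableUnderComposition] {X : C} (U V : EOver E X) : EOver E X :=
  ⟨(pull U.hom V).left, (pull U.hom V).hom ≫ U.hom, E.comp_mem _ _ (pull U.hom V).prop U.prop⟩

lemma fac_meet_iff [E.IsStableUnderComposition] {A X : C} (h : A ⟶ X) (U V : EOver E X) :
    Fac h (meet U V) ↔ Fac h U ∧ Fac h V := by
  constructor
  · rintro ⟨m, rfl⟩
    refine ⟨⟨m ≫ (pull U.hom V).hom, Category.assoc _ _ _⟩, ?_⟩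
    exact ((fac_pull_iff _ _ _).mp (fac_self (pull U.hom V))).comp m
  · rintro ⟨⟨m, rfl⟩, h⟩
    obtain ⟨k, hk⟩ := (fac_pull_iff m U.hom V).mpr h
    exact ⟨k, by change k ≫ (pull U.hom V).hom ≫ U.hom = _; rw [← Category.assoc, hk]⟩

end EOver

end CohSite

open CohSite CohSite.EOver in
/-- A category `C` with a class `ℰ` of morphisms and a coherent Grothendieck topology `𝒪`: for each
object `X` a family `𝒪_X` of finite sets of `ℰ`-morphisms with target `X`. Only those axioms of a
coherent site are recorded that are needed for the lattices `Ω₁(X)` to be defined and to be small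
sets. -/
structure CohSite (C : Type (u + 1)) [Category.{u} C] where
  E : MorphismProperty C
  [isMultiplicative : E.IsMultiplicative]
  [isStableUnderBaseChange : E.IsStableUnderBaseChange]
  [hasPullbacks : E.HasPullbacks]
  mono : ∀ {X Y : C} (f : X ⟶ Y), E f → Mono f
  small : ∀ X : C, ∃ (ι : Type u) (F : ι → EOver E X), ∀ U : EOver E X, ∃ i,
    Fac U.hom (F i) ∧ Fac (F i).hom U
  cov : ∀ X : C, Set (Set (EOver E X))
  finite : ∀ {X : C} {S : Set (EOver E X)}, S ∈ cov X → S.Finite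
  iso_mem : ∀ {X : C} (U : EOver E X), IsIso U.hom → {U} ∈ cov X
  superset_mem : ∀ {X : C} {S T : Set (EOver E X)}, S ⊆ T → T.Finite → S ∈ cov X → T ∈ cov X
  pull_mem : ∀ {X Y : C} (f : X ⟶ Y) {S : Set (EOver E Y)}, S ∈ cov Y → pull f '' S ∈ cov X
  trans_mem : ∀ {X : C} {S T : Set (EOver E X)}, S ∈ cov X → T.Finite →
    (∀ V ∈ S, pull V.hom '' T ∈ cov V.left) → T ∈ cov X

namespace CohSite

open EOver

attribute [instance] isMultiplicative isStableUnderBaseChange hasPullbacks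

variable {C : Type (u + 1)} [Category.{u} C] (𝒞 : CohSite C)

/-- The set `Ω₀(X)` of finite sets of `ℰ`-morphisms with target `X`. -/
def Omega0 (X : C) : Type (u + 1) := {S : Set (EOver 𝒞.E X) // S.Finite}

variable {𝒞}

lemma singleton_pull_mem {A X : C} {h : A ⟶ X} {V : EOver 𝒞.E X} (H : Fac h V) :
    {pull h V} ∈ 𝒞.cov A := by
  apply 𝒞.iso_mem
  obtain ⟨m, hm⟩ : Fac (𝟙 A) (pull h V) := (fac_pull_iff _ _ _).mpr (by rwa [Category.id_comp])
  have := 𝒞.mono _ (pull h V).prop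
  exact ⟨m, by rw [← cancel_mono (pull h V).hom, Category.assoc, hm, Category.comp_id,
    Category.id_comp], hm⟩

lemma pull_image_mem {A X : C} {h : A ⟶ X} {T : Set (EOver 𝒞.E X)} (hT : T.Finite)
    (H : ∃ V ∈ T, Fac h V) : pull h '' T ∈ 𝒞.cov A := by
  obtain ⟨V, hV, H⟩ := H
  refine 𝒞.superset_mem ?_ (hT.image _) (singleton_pull_mem H)
  rintro _ rfl
  exact ⟨V, hV, rfl⟩

lemma refine_mem {X : C} {S T : Set (EOver 𝒞.E X)} (hS : S ∈ 𝒞.cov X) (hT : T.Finite)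
    (H : ∀ U ∈ S, ∃ V ∈ T, Fac U.hom V) : T ∈ 𝒞.cov X :=
  𝒞.trans_mem hS hT fun U hU => pull_image_mem hT (H U hU)

namespace Omega0

variable {X : C}

/-- The relation `{U_i} ≺ {V_j}`: for all `i`, the family `{U_i ×_X V_j → U_i}_j` is a covering. -/
def Prec (S T : 𝒞.Omega0 X) : Prop := ∀ U ∈ S.1, pull U.hom '' T.1 ∈ 𝒞.cov U.left

lemma prec_of_fac {S T : 𝒞.Omega0 X} (H : ∀ U ∈ S.1, ∃ V ∈ T.1, Fac U.hom V) : Prec S T :=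
  fun U hU => pull_image_mem T.2 (H U hU)

lemma Prec.refl (S : 𝒞.Omega0 X) : Prec S S := prec_of_fac fun U hU => ⟨U, hU, fac_self U⟩

/-- If `T` covers `U` and `q : A → U`, then a family that is refined by `T` on `A` covers `A`. -/
lemma transport {U A : C} {T : Set (EOver 𝒞.E X)} {R : Set (EOver 𝒞.E A)} {h : U ⟶ X}
    (hT : pull h '' T ∈ 𝒞.cov U) (q : A ⟶ U) (hR : R.Finite)
    (H : ∀ (B : C) (k : B ⟶ A), ∀ V ∈ T, Fac (k ≫ q ≫ h) V → ∃ W ∈ R, Fac k W) :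
    R ∈ 𝒞.cov A := by
  refine refine_mem (𝒞.pull_mem q hT) hR ?_
  rintro _ ⟨_, ⟨V, hV, rfl⟩, rfl⟩
  refine H _ _ V hV ?_
  have := (fac_pull_iff _ _ _).mp ((fac_pull_iff _ _ _).mp (fac_self (pull q (pull h V))))
  rwa [Category.assoc] at this

lemma Prec.trans {S T R : 𝒞.Omega0 X} (h : Prec S T) (h' : Prec T R) : Prec S R := by
  intro U hU
  refine 𝒞.trans_mem (h U hU) (R.2.image _) ?_
  rintro _ ⟨V, hV, rfl⟩
  obtain ⟨q, hq⟩ := pull_isPullback U.hom V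
  refine transport (h' V hV) q ((R.2.image _).image _) fun B k W hW H => ?_
  refine ⟨_, ⟨_, ⟨W, hW, rfl⟩, rfl⟩, ?_⟩
  rwa [fac_pull_iff, fac_pull_iff, Category.assoc, ← hq.w]

/-- The join `{U_i}_{i ∈ I} ∨ {U_i}_{i ∈ J} = {U_i}_{i ∈ I ∐ J}`. -/
def sup (S T : 𝒞.Omega0 X) : 𝒞.Omega0 X := ⟨S.1 ∪ T.1, S.2.union T.2⟩

/-- The meet `{U_i}_i ∧ {V_j}_j = {U_i ×_X V_j}_{i, j}`. -/
def inf (S T : 𝒞.Omega0 X) : 𝒞.Omega0 X := ⟨Set.image2 meet S.1 T.1, S.2.image2 _ T.2⟩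

lemma prec_sup_left (S T : 𝒞.Omega0 X) : Prec S (sup S T) :=
  prec_of_fac fun U hU => ⟨U, Or.inl hU, fac_self U⟩

lemma prec_sup_right (S T : 𝒞.Omega0 X) : Prec T (sup S T) :=
  prec_of_fac fun U hU => ⟨U, Or.inr hU, fac_self U⟩

lemma sup_prec {S T R : 𝒞.Omega0 X} (h : Prec S R) (h' : Prec T R) : Prec (sup S T) R := by
  rintro U (hU | hU)
  · exact h U hU
  · exact h' U hU

lemma inf_prec_left (S T : 𝒞.Omega0 X) : Prec (inf S T) S := prec_of_fac (by
  rintro _ ⟨U, hU, V, _, rfl⟩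
  exact ⟨U, hU, ((fac_meet_iff _ _ _).mp (fac_self (meet U V))).1⟩)

lemma inf_prec_right (S T : 𝒞.Omega0 X) : Prec (inf S T) T := prec_of_fac (by
  rintro _ ⟨U, _, V, hV, rfl⟩
  exact ⟨V, hV, ((fac_meet_iff _ _ _).mp (fac_self (meet U V))).2⟩)

lemma prec_inf {R S T : 𝒞.Omega0 X} (h : Prec R S) (h' : Prec R T) : Prec R (inf S T) := by
  intro W hW
  refine 𝒞.trans_mem (h W hW) ((inf S T).2.image _) ?_
  rintro _ ⟨U, hU, rfl⟩
  refine transport (h' W hW) (pull W.hom U).hom (((inf S T).2.image _).image _)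
    fun B k V hV H => ⟨_, ⟨_, ⟨meet U V, ⟨U, hU, V, hV, rfl⟩, rfl⟩, rfl⟩, ?_⟩
  rw [fac_pull_iff, fac_pull_iff, fac_meet_iff, Category.assoc]
  exact ⟨((fac_pull_iff _ _ _).mp (fac_self (pull W.hom U))).comp k, H⟩

/-- The base change of a finite family of `ℰ`-morphisms. -/
def base {Y : C} (f : Y ⟶ X) (S : 𝒞.Omega0 X) : 𝒞.Omega0 Y := ⟨pull f '' S.1, S.2.image _⟩

lemma Prec.base {Y : C} (f : Y ⟶ X) {S T : 𝒞.Omega0 X} (h : Prec S T) :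
    Prec (base f S) (base f T) := by
  rintro _ ⟨U, hU, rfl⟩
  obtain ⟨q, hq⟩ := pull_isPullback f U
  refine transport (h U hU) q ((T.2.image _).image _) fun B k V hV H =>
    ⟨_, ⟨_, ⟨V, hV, rfl⟩, rfl⟩, ?_⟩
  rwa [fac_pull_iff, fac_pull_iff, Category.assoc, ← hq.w]

end Omega0

variable (𝒞) in
/-- The equivalence relation on `Ω₀(X)` generated by `≺`. -/
def omegaSetoid (X : C) : Setoid (𝒞.Omega0 X) where
  r S T := S.Prec T ∧ T.Prec S
  iseqv := ⟨fun S => ⟨.refl S, .refl S⟩, fun h => ⟨h.2, h.1⟩,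
    fun h h' => ⟨h.1.trans h'.1, h'.2.trans h.2⟩⟩

variable (𝒞) in
/-- The distributive lattice `Ω₁(X) = Ω₀(X) / ≡`. -/
def Omega1 (X : C) : Type (u + 1) := Quotient (𝒞.omegaSetoid X)

namespace Omega1

variable {X : C}

/-- The class of a finite family of `ℰ`-morphisms. -/
def mk (S : 𝒞.Omega0 X) : 𝒞.Omega1 X := Quotient.mk _ S

lemma ind {p : 𝒞.Omega1 X → Prop} (h : ∀ S, p (mk S)) (x : 𝒞.Omega1 X) : p x := Quotient.ind h x

lemma mk_eq_iff {S T : 𝒞.Omega0 X} : mk S = mk T ↔ S.Prec T ∧ T.Prec S := Quotient.eq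

open Omega0

instance : Max (𝒞.Omega1 X) := ⟨Quotient.map₂ sup fun _ _ h _ _ h' =>
  ⟨sup_prec (h.1.trans (prec_sup_left _ _)) (h'.1.trans (prec_sup_right _ _)),
    sup_prec (h.2.trans (prec_sup_left _ _)) (h'.2.trans (prec_sup_right _ _))⟩⟩

instance : Min (𝒞.Omega1 X) := ⟨Quotient.map₂ inf fun _ _ h _ _ h' =>
  ⟨prec_inf ((inf_prec_left _ _).trans h.1) ((inf_prec_right _ _).trans h'.1),
    prec_inf ((inf_prec_left _ _).trans h.2) ((inf_prec_right _ _).trans h'.2)⟩⟩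

instance : PartialOrder (𝒞.Omega1 X) where
  le := Quotient.lift₂ Prec fun _ _ _ _ h h' => propext
    ⟨fun H => (h.2.trans H).trans h'.1, fun H => (h.1.trans H).trans h'.2⟩
  le_refl := ind Prec.refl
  le_trans := ind fun _ => ind fun _ => ind fun _ h h' => Prec.trans h h'
  le_antisymm := ind fun _ => ind fun _ h h' => mk_eq_iff.mpr ⟨h, h'⟩

lemma mk_le_iff {S T : 𝒞.Omega0 X} : mk S ≤ mk T ↔ S.Prec T := Iff.rfl

instance : Lattice (𝒞.Omega1 X) where
  sup x y := x ⊔ y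
  inf x y := x ⊓ y
  le_sup_left := ind fun S => ind fun T => prec_sup_left S T
  le_sup_right := ind fun S => ind fun T => prec_sup_right S T
  sup_le := ind fun _ => ind fun _ => ind fun _ => sup_prec
  inf_le_left := ind fun S => ind fun T => inf_prec_left S T
  inf_le_right := ind fun S => ind fun T => inf_prec_right S T
  le_inf := ind fun _ => ind fun _ => ind fun _ => prec_inf

instance : DistribLattice (𝒞.Omega1 X) :=
  DistribLattice.ofInfSupLe <| ind fun S => ind fun T => ind fun R => prec_of_fac (by
    rintro _ ⟨U, hU, V, hV | hV, rfl⟩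
    · exact ⟨_, Or.inl ⟨U, hU, V, hV, rfl⟩, fac_self _⟩
    · exact ⟨_, Or.inr ⟨U, hU, V, hV, rfl⟩, fac_self _⟩)

instance : BoundedOrder (𝒞.Omega1 X) where
  top := mk ⟨{EOver.refl X}, Set.finite_singleton _⟩
  bot := mk ⟨∅, Set.finite_empty⟩
  le_top := ind fun _ => prec_of_fac fun _ _ => ⟨EOver.refl X, rfl, fac_refl _⟩
  bot_le := ind fun _ => prec_of_fac fun _ hU => hU.elim

/-- The homomorphism `Ω₁(X) → Ω₁(Y)`, `{U_i} ↦ {Y ×_X U_i}`, induced by `f : Y → X`. -/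
def map {Y : C} (f : Y ⟶ X) : BoundedLatticeHom (𝒞.Omega1 X) (𝒞.Omega1 Y) where
  toFun := Quotient.map (base f) fun S T h => ⟨h.1.base f, h.2.base f⟩
  map_sup' := ind fun S => ind fun T => congrArg mk (Subtype.ext (Set.image_union _ _ _))
  map_inf' := ind fun S => ind fun T => mk_eq_iff.mpr ⟨prec_of_fac (by
    rintro _ ⟨_, ⟨U, hU, V, hV, rfl⟩, rfl⟩
    refine ⟨_, ⟨_, ⟨U, hU, rfl⟩, _, ⟨V, hV, rfl⟩, rfl⟩, ?_⟩
    rw [fac_meet_iff, fac_pull_iff, fac_pull_iff, ← fac_meet_iff, ← fac_pull_iff]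
    exact fac_self _), prec_of_fac (by
    rintro _ ⟨_, ⟨U, hU, rfl⟩, _, ⟨V, hV, rfl⟩, rfl⟩
    refine ⟨_, ⟨_, ⟨U, hU, V, hV, rfl⟩, rfl⟩, ?_⟩
    rw [fac_pull_iff, fac_meet_iff, ← fac_pull_iff, ← fac_pull_iff, ← fac_meet_iff]
    exact fac_self _)⟩
  map_top' := mk_eq_iff.mpr ⟨prec_of_fac fun U _ => ⟨EOver.refl Y, rfl, fac_refl _⟩,
    prec_of_fac fun U _ => ⟨_, ⟨EOver.refl X, rfl, rfl⟩, (fac_pull_iff _ _ _).mpr (fac_refl _)⟩⟩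
  map_bot' := congrArg mk (Subtype.ext (Set.image_empty _))

lemma map_mk {Y : C} (f : Y ⟶ X) (S : 𝒞.Omega0 X) : map f (mk S) = mk (base f S) := rfl

lemma map_id (x : 𝒞.Omega1 X) : map (𝟙 X) x = x := by
  induction x using ind with
  | h S =>
    refine mk_eq_iff.mpr ⟨prec_of_fac ?_, prec_of_fac fun U hU => ⟨_, ⟨U, hU, rfl⟩, ?_⟩⟩
    · rintro _ ⟨U, hU, rfl⟩
      refine ⟨U, hU, ?_⟩
      have := (fac_pull_iff _ _ _).mp (fac_self (pull (𝟙 X) U))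
      rwa [Category.comp_id] at this
    · rw [fac_pull_iff, Category.comp_id]
      exact fac_self U

lemma map_comp {Y Z : C} (g : Z ⟶ Y) (f : Y ⟶ X) (x : 𝒞.Omega1 X) :
    map (g ≫ f) x = map g (map f x) := by
  induction x using ind with
  | h S =>
    refine mk_eq_iff.mpr ⟨prec_of_fac ?_, prec_of_fac ?_⟩
    · rintro _ ⟨U, hU, rfl⟩
      refine ⟨_, ⟨_, ⟨U, hU, rfl⟩, rfl⟩, ?_⟩
      rw [fac_pull_iff, fac_pull_iff, Category.assoc, ← fac_pull_iff]
      exact fac_self _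
    · rintro _ ⟨_, ⟨U, hU, rfl⟩, rfl⟩
      refine ⟨_, ⟨U, hU, rfl⟩, ?_⟩
      rw [fac_pull_iff, ← Category.assoc, ← fac_pull_iff, ← fac_pull_iff]
      exact fac_self _

instance : Small.{u} (𝒞.Omega1 X) := by
  obtain ⟨ι, F, hF⟩ := 𝒞.small X
  refine small_of_surjective (α := {s : Set ι // s.Finite})
    (f := fun s => mk ⟨F '' s.1, s.2.image F⟩) (ind fun S => ?_)
  choose i hi hi' using hF
  refine ⟨⟨i '' S.1, S.2.image i⟩, mk_eq_iff.mpr ⟨prec_of_fac ?_, prec_of_fac fun U hU => ?_⟩⟩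
  · rintro _ ⟨_, ⟨U, hU, rfl⟩, rfl⟩
    exact ⟨U, hU, hi' U⟩
  · exact ⟨_, ⟨_, ⟨U, hU, rfl⟩, rfl⟩, hi U⟩

end Omega1

instance (L : Type (u + 1)) [DistribLattice L] [Small.{u} L] : DistribLattice (Shrink.{u} L) :=
  letI : Max (Shrink.{u} L) := ⟨fun a b => equivShrink L ((equivShrink L).symm a ⊔
    (equivShrink L).symm b)⟩
  letI : Min (Shrink.{u} L) := ⟨fun a b => equivShrink L ((equivShrink L).symm a ⊓
    (equivShrink L).symm b)⟩
  (equivShrink L).symm.injective.distribLattice _ Iff.rfl Iff.rfl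
    (fun _ _ => Equiv.symm_apply_apply _ _) (fun _ _ => Equiv.symm_apply_apply _ _)

instance (L : Type (u + 1)) [DistribLattice L] [BoundedOrder L] [Small.{u} L] :
    BoundedOrder (Shrink.{u} L) where
  le_top _ := le_top
  bot_le _ := bot_le

/-- A small lattice, as an isomorphic lattice in the universe `u`. -/
def shrinkIso (L : Type (u + 1)) [DistribLattice L] [BoundedOrder L] [Small.{u} L] :
    L ≃o Shrink.{u} L where
  toEquiv := equivShrink L
  map_rel_iff' := (orderIsoShrink.{u} L).map_rel_iff

/-- The homomorphism induced by `f : Y → X` between the small copies of the lattices `Ω₁`. -/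
def omegaMap {X Y : C} (f : Y ⟶ X) :
    BoundedLatticeHom (Shrink.{u} (𝒞.Omega1 X)) (Shrink.{u} (𝒞.Omega1 Y)) :=
  ((shrinkIso (𝒞.Omega1 Y) : BoundedLatticeHom (𝒞.Omega1 Y) (Shrink.{u} (𝒞.Omega1 Y))).comp
    (Omega1.map f)).comp
      ((shrinkIso (𝒞.Omega1 X)).symm : BoundedLatticeHom (Shrink.{u} (𝒞.Omega1 X)) (𝒞.Omega1 X))

lemma omegaMap_apply {X Y : C} (f : Y ⟶ X) (x : Shrink.{u} (𝒞.Omega1 X)) :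
    omegaMap f x = shrinkIso _ (Omega1.map f ((shrinkIso _).symm x)) := rfl

variable (𝒞) in
/-- The contravariant functor `Ω₁` to distributive lattices. -/
def omegaFunctor : Cᵒᵖ ⥤ BddDistLat.{u} where
  obj X := BddDistLat.of (Shrink.{u} (𝒞.Omega1 X.unop))
  map f := BddDistLat.ofHom (omegaMap f.unop)
  map_id X := by
    refine BddDistLat.ext fun x => ?_
    change omegaMap (𝟙 X.unop) x = x
    rw [omegaMap_apply, Omega1.map_id, OrderIso.apply_symm_apply]
  map_comp {X Y Z} f g := by
    refine BddDistLat.ext fun x => ?_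
    change omegaMap (g.unop ≫ f.unop) x = omegaMap g.unop (omegaMap f.unop x)
    rw [omegaMap_apply, omegaMap_apply, omegaMap_apply, Omega1.map_comp,
      OrderIso.symm_apply_apply]

end CohSite

namespace Coh

open CohSite CohSite.EOver

variable {D : Type (u + 1)} [Category.{u} D] (𝒞 : CohSite Dᵒᵖ)

/-- For `C = Dᵒᵖ`, the functor `R ↦ Ω₁(R)`, as a covariant functor on `D = Cᵒᵖ`. -/
def omegaLattice : D ⥤ BddDistLat.{u} := opOp D ⋙ 𝒞.omegaFunctor

/-- The element `{j}` of `Ω₁(R)`, for an `ℰ`-morphism `j : A → R`. -/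
def singleClass {R : D} (j : EOver 𝒞.E (op R)) : (omegaLattice 𝒞).obj R :=
  shrinkIso (𝒞.Omega1 (op R)) (Omega1.mk ⟨{j}, Set.finite_singleton j⟩)

/-- For quasi-compact open subsets `T ⊆ U`, the restriction `O_X(T) → O_X(U)`, which is a morphism
of `C = Dᵒᵖ`, factors through the `ℰ`-morphism `j : A → O_X(U)` whenever `β_X(U)({j}) ≥ T`. -/
def IsWeakScheme : ObjectProperty (SupportedSpace (omegaLattice 𝒞)) := fun X =>
  ∀ (T U : CompactOpens X.carrier) (h : T ≤ U) (j : EOver 𝒞.E (op (X.O.obj.obj (op U)))),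
    T ≤ X.support (singleClass 𝒞 j) → Fac (X.O.obj.map (homOfLE h).op).op j

/-- The category of weak `C`-schemes, for `C = Dᵒᵖ`. -/
abbrev WeakScheme : Type (u + 1) := (IsWeakScheme 𝒞).FullSubcategory

end Coh
/-! ### The Zariski topology -/

namespace WAlg

open CohSite CohSite.EOver

variable {V : AlgType.{u}}

section Localization

variable {R A B : WAlg V}

lemma IsLoc.congr {S T : Submonoid R} {g : R ⟶ A} (hg : IsLoc S g)
    (h : ∀ (B : WAlg V) (k : R ⟶ B),
      (∀ s ∈ S, IsUnit (k.hom s)) ↔ ∀ t ∈ T, IsUnit (k.hom t)) : IsLoc T g :=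
  ⟨(h A g).mp hg.1, fun B k hk => hg.2 B k ((h B k).mpr hk)⟩

lemma isUnit_powers_iff (k : R ⟶ B) (r : R) :
    (∀ s ∈ Submonoid.powers r, IsUnit (k.hom s)) ↔ IsUnit (k.hom r) := by
  constructor
  · exact fun h => h r (Submonoid.mem_powers r)
  · rintro h _ ⟨n, rfl⟩
    change IsUnit (k.hom (r ^ n))
    rw [map_pow]
    exact h.pow n

lemma isUnit_closure_iff (k : R ⟶ B) (t : Finset R) :
    (∀ s ∈ Submonoid.closure (t : Set R), IsUnit (k.hom s)) ↔ IsUnit (k.hom (∏ x ∈ t, x)) := by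
  constructor
  · exact fun h => h _ (Submonoid.prod_mem _ fun x hx => Submonoid.subset_closure hx)
  · intro h s hs
    induction hs using Submonoid.closure_induction with
    | mem x hx => exact isUnit_of_dvd_unit (map_dvd k.hom (Finset.dvd_prod_of_mem _ hx)) h
    | one => rw [map_one]; exact isUnit_one
    | mul x y _ _ hx hy => rw [map_mul]; exact hx.mul hy

lemma isLoc_of_isIso (g : R ⟶ A) [IsIso g] : IsLoc (Submonoid.powers 1) g := by
  refine ⟨(isUnit_powers_iff g 1).mpr (by rw [map_one]; exact isUnit_one), fun B h _ =>
    ⟨inv g ≫ h, by simp, fun k hk => ?_⟩⟩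
  rw [← hk, IsIso.inv_hom_id_assoc]

lemma IsLoc.comp {r x : R} {a : A} {n : ℕ} {g : R ⟶ A} {h : A ⟶ B}
    (hg : IsLoc (Submonoid.powers r) g) (hh : IsLoc (Submonoid.powers a) h)
    (e : g.hom (r ^ n) * a = g.hom x) : IsLoc (Submonoid.powers (r * x)) (g ≫ h) := by
  have hr := (isUnit_powers_iff g r).mp hg.1
  have ha := (isUnit_powers_iff h a).mp hh.1
  constructor
  · rw [isUnit_powers_iff, map_mul, comp_hom, comp_hom, ← e, map_mul, map_pow]
    exact (hr.map h.hom).mul (((hr.pow n).map h.hom).mul ha)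
  · intro C k hk
    rw [isUnit_powers_iff, map_mul, IsUnit.mul_iff] at hk
    obtain ⟨l, rfl, hl⟩ := hg.2 C k ((isUnit_powers_iff k r).mpr hk.1)
    have h2 := hk.2
    rw [comp_hom, ← e, map_mul, IsUnit.mul_iff] at h2
    obtain ⟨m, rfl, hm⟩ := hh.2 C l ((isUnit_powers_iff l a).mpr h2.2)
    refine ⟨m, Category.assoc _ _ _, fun m' hm' => hm _ (hl _ ?_)⟩
    rw [← hm']
    exact (Category.assoc _ _ _).symm

lemma isUnit_map_iff {S : Submonoid R} (f : R ⟶ A) (k : A ⟶ B) :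
    (∀ t ∈ S.map f.hom, IsUnit (k.hom t)) ↔ ∀ s ∈ S, IsUnit ((f ≫ k).hom s) :=
  ⟨fun h s hs => h _ ⟨s, hs, rfl⟩, by rintro h _ ⟨s, hs, rfl⟩; exact h s hs⟩

/-- Localizations are stable under cobase change. -/
lemma IsLoc.of_isPushout {P : WAlg V} {S : Submonoid R} {g : R ⟶ A} {f : R ⟶ B} {i : A ⟶ P}
    {j : B ⟶ P} (hg : IsLoc S g) (sq : IsPushout g f i j) : IsLoc (S.map f.hom) j := by
  constructor
  · rw [isUnit_map_iff, ← sq.w]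
    exact fun s hs => (hg.1 s hs).map i.hom
  · intro C k hk
    rw [isUnit_map_iff] at hk
    obtain ⟨l, hl, -⟩ := hg.2 C (f ≫ k) hk
    refine ⟨sq.desc l k hl, sq.inr_desc _ _ _, fun m hm => sq.hom_ext ?_ ?_⟩
    · obtain ⟨_, _, hu⟩ := hg.2 C (f ≫ k) hk
      rw [hu (i ≫ m) (by change g ≫ i ≫ m = _; rw [← Category.assoc, sq.w, Category.assoc, hm]),
        hu (i ≫ sq.desc l k hl) (by change g ≫ i ≫ _ = _; rw [sq.inl_desc, hl])]
    · rw [hm, sq.inr_desc]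

lemma IsLoc.epi {S : Submonoid R} {g : R ⟶ A} (hg : IsLoc S g) : Epi g := by
  refine ⟨fun {C} k l h => (hg.2 C (g ≫ k) fun s hs => ?_).unique rfl h.symm⟩
  exact (hg.1 s hs).map k.hom

/-- The cobase change of a localization. -/
lemma IsLoc.exists_isPushout {S : Submonoid R} {g : R ⟶ A} (hg : IsLoc S g) (f : R ⟶ B) :
    ∃ i : A ⟶ loc (S.map f.hom), IsPushout g f i (toLoc (S.map f.hom)) := by
  have hj := isLoc_toLoc (S.map f.hom)
  obtain ⟨i, hi, -⟩ := hg.2 _ (f ≫ toLoc (S.map f.hom)) ((isUnit_map_iff f _).mp hj.1)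
  have hu : ∀ {C : WAlg V} (k : A ⟶ C) (l : B ⟶ C), g ≫ k = f ≫ l →
      ∃! m, toLoc (S.map f.hom) ≫ m = l := fun {C} k l h => hj.2 C l <| by
    rw [isUnit_map_iff, ← h]
    exact fun s hs => (hg.1 s hs).map k.hom
  have := hg.epi
  refine ⟨i, ⟨⟨hi⟩, ⟨Limits.PushoutCocone.IsColimit.mk hi
    (fun s => (hu s.inl s.inr s.condition).choose) (fun s => ?_) (fun s => ?_)
    (fun s m h1 h2 => (hu s.inl s.inr s.condition).unique h2 ?_)⟩⟩⟩
  · rw [← cancel_epi g, ← Category.assoc, hi, Category.assoc,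
      (hu s.inl s.inr s.condition).choose_spec.1, s.condition]
  · exact (hu s.inl s.inr s.condition).choose_spec.1
  · exact (hu s.inl s.inr s.condition).choose_spec.1

end Localization

variable (V) in
/-- The localizations of finite type `S⁻¹R → R`, as morphisms of the opposite category of
`W`-algebras: the multiplicative system `S` is finitely generated. -/
def finTypeLoc : MorphismProperty (WAlg V)ᵒᵖ := fun _ Y f =>
  ∃ S : Submonoid Y.unop, S.FG ∧ IsLoc S f.unop

lemma finTypeLoc_iff {X Y : (WAlg V)ᵒᵖ} (f : X ⟶ Y) :
    finTypeLoc V f ↔ ∃ r : Y.unop, IsLoc (Submonoid.powers r) f.unop := by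
  constructor
  · rintro ⟨_, ⟨t, rfl⟩, h⟩
    exact ⟨∏ x ∈ t, x, h.congr fun B k => by rw [isUnit_closure_iff, isUnit_powers_iff]⟩
  · rintro ⟨r, h⟩
    exact ⟨_, ⟨{r}, by rw [Finset.coe_singleton, Submonoid.powers_eq_closure]⟩, h⟩

instance : (finTypeLoc V).IsMultiplicative where
  id_mem X := (finTypeLoc_iff _).mpr ⟨1, isLoc_of_isIso (𝟙 X.unop)⟩
  comp_mem f g hf hg := by
    rw [finTypeLoc_iff] at hf hg ⊢
    obtain ⟨a, ha⟩ := hf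
    obtain ⟨r, hr⟩ := hg
    obtain ⟨_, ⟨n, rfl⟩, x, hx⟩ := hr.surj a
    exact ⟨r * x, hr.comp ha hx⟩

instance : (finTypeLoc V).IsStableUnderBaseChange where
  of_isPullback {X Y Y' Z f g f' g'} sq hg := by
    obtain ⟨S, hS, h⟩ := hg
    exact ⟨S.map f.unop.hom, hS.map _, h.of_isPushout sq.unop.flip⟩

instance : (finTypeLoc V).HasPullbacks where
  hasPullback {X Y Z f} g hf := by
    obtain ⟨S, hS, h⟩ := hf
    obtain ⟨i, hi⟩ := h.exists_isPushout g.unop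
    exact hi.op.flip.hasPullback

lemma isLoc_pull {X Y : (WAlg V)ᵒᵖ} (f : X ⟶ Y) (U : EOver (finTypeLoc V) Y) {r : Y.unop}
    (h : IsLoc (Submonoid.powers r) U.hom.unop) :
    IsLoc (Submonoid.powers (f.unop.hom r)) (pull f U).hom.unop := by
  obtain ⟨q, hq⟩ := pull_isPullback f U
  have := h.of_isPushout hq.unop.flip
  rwa [Submonoid.map_powers] at this

variable (V) in
/-- The Zariski coverings: the finite sets `{R_{f_i} → R}_i` such that the ideal generated by the
elements `f_i` is the unit ideal. -/
def zariskiCov (X : (WAlg V)ᵒᵖ) : Set (Set (EOver (finTypeLoc V) X)) :=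
  {S | ∃ (n : ℕ) (f : Fin n → X.unop) (U : Fin n → EOver (finTypeLoc V) X),
    (∀ i, IsLoc (Submonoid.powers (f i)) (U i).hom.unop) ∧ Set.range U = S ∧
      Idl.span (Set.range f) = 1}

lemma mem_zariskiCov_of_finite {X : (WAlg V)ᵒᵖ} {S : Set (EOver (finTypeLoc V) X)} {ι : Type*}
    [Finite ι] (f : ι → X.unop) (U : ι → EOver (finTypeLoc V) X)
    (h : ∀ i, IsLoc (Submonoid.powers (f i)) (U i).hom.unop) (hS : Set.range U = S)
    (hf : Idl.span (Set.range f) = 1) : S ∈ zariskiCov V X := by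
  obtain ⟨n, ⟨e⟩⟩ := Finite.exists_equiv_fin ι
  exact ⟨n, f ∘ e.symm, U ∘ e.symm, fun i => h _, by rw [e.symm.surjective.range_comp, hS],
    by rw [e.symm.surjective.range_comp, hf]⟩

lemma exists_elements {X : (WAlg V)ᵒᵖ} {T : Set (EOver (finTypeLoc V) X)} (hT : T.Finite) :
    ∃ (n : ℕ) (f : Fin n → X.unop) (U : Fin n → EOver (finTypeLoc V) X),
      (∀ i, IsLoc (Submonoid.powers (f i)) (U i).hom.unop) ∧ Set.range U = T := by
  have := hT.to_subtype
  obtain ⟨n, ⟨e⟩⟩ := Finite.exists_equiv_fin T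
  choose f hf using fun i => (finTypeLoc_iff (e.symm i).1.hom).mp (e.symm i).1.prop
  refine ⟨n, f, fun i => (e.symm i).1, hf, ?_⟩
  rw [show (fun i => (e.symm i).1) = Subtype.val ∘ e.symm from rfl, e.symm.surjective.range_comp,
    Subtype.range_val]

lemma zariski_pull_mem {X Y : (WAlg V)ᵒᵖ} (f : X ⟶ Y) {S : Set (EOver (finTypeLoc V) Y)}
    (hS : S ∈ zariskiCov V Y) : pull f '' S ∈ zariskiCov V X := by
  obtain ⟨n, a, U, hU, rfl, ha⟩ := hS
  refine ⟨n, fun i => f.unop.hom (a i), fun i => pull f (U i), fun i => isLoc_pull f _ (hU i),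
    Set.range_comp (pull f) U, ?_⟩
  rw [show (fun i => f.unop.hom (a i)) = f.unop.hom ∘ a from rfl, Set.range_comp, ← Idl.map_span,
    ha]
  exact Idl.map_one' _

lemma zariski_trans_mem {X : (WAlg V)ᵒᵖ} {S T : Set (EOver (finTypeLoc V) X)}
    (hS : S ∈ zariskiCov V X) (hT : T.Finite)
    (h : ∀ U ∈ S, pull U.hom '' T ∈ zariskiCov V U.left) : T ∈ zariskiCov V X := by
  obtain ⟨n, f, U, hU, rfl, hf⟩ := hS
  obtain ⟨m, g, W, hW, rfl⟩ := exists_elements hT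
  refine ⟨m, g, W, hW, rfl, ?_⟩
  set J := Idl.span (Set.range g)
  have key : ∀ i, ∃ k : ℕ, f i ^ k ∈ J := by
    intro i
    obtain ⟨l, a, Z, hZ, hZr, ha⟩ := h _ ⟨i, rfl⟩
    set φ : X.unop ⟶ (U i).left.unop := (U i).hom.unop
    have h1 : ∀ j, ∃ k : ℕ, a j ^ k ∈ Idl.map φ J := by
      intro j
      have hj : Z j ∈ pull (U i).hom '' Set.range W := hZr ▸ ⟨j, rfl⟩
      obtain ⟨_, ⟨p, rfl⟩, hp⟩ := hj
      have h2 := hZ j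
      rw [← hp] at h2
      have h3 := isLoc_pull (U i).hom _ (hW p)
      have h4 : Idl.map (pull (U i).hom (W p)).hom.unop (Idl.map φ J) = 1 := by
        rw [Idl.eq_one_iff]
        obtain ⟨c, hc⟩ := ((isUnit_powers_iff _ _).mp h3.1).exists_left_inv
        rw [← hc]
        refine Idl.mul_mem _ _ _ (Idl.subset_span _ ⟨_, Idl.subset_span _ ⟨g p,
          Idl.subset_span _ ⟨p, rfl⟩, rfl⟩, rfl⟩)
      obtain ⟨_, ⟨k, rfl⟩, hk⟩ := h2.of_mem_map (Idl.map φ J) (x := 1) (by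
        rw [h4]; exact Idl.mem_one _)
      exact ⟨k, by rwa [mul_one] at hk⟩
    obtain ⟨N, hN⟩ := Idl.pow_span_le (Set.finite_range a) (J := Idl.map φ J) (by
      rintro _ ⟨j, rfl⟩; exact h1 j)
    rw [ha, one_pow] at hN
    obtain ⟨_, ⟨k, rfl⟩, hk⟩ := (hU i).of_mem_map J (x := 1) (by
      change φ.hom 1 ∈ Idl.map φ J
      exact hN (Idl.mem_one _))
    exact ⟨k, by rwa [mul_one] at hk⟩
  obtain ⟨N, hN⟩ := Idl.pow_span_le (Set.finite_range f) (J := J) (by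
    rintro _ ⟨i, rfl⟩; exact key i)
  rw [hf, one_pow] at hN
  exact le_antisymm (Idl.le_one _) hN

variable (V) in
/-- The opposite category of `W`-algebras, with the Zariski topology. -/
def zariskiSite : CohSite.{u} (WAlg V)ᵒᵖ where
  E := finTypeLoc V
  mono f hf := by
    obtain ⟨S, -, h⟩ := hf
    have := h.epi
    exact inferInstanceAs (Mono f.unop.op)
  small X := by
    refine ⟨X.unop, fun r => ⟨op (loc (Submonoid.powers r)), (toLoc (Submonoid.powers r)).op,
      (finTypeLoc_iff _).mpr ⟨r, isLoc_toLoc _⟩⟩, fun U => ?_⟩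
    obtain ⟨r, hr⟩ := (finTypeLoc_iff _).mp U.prop
    obtain ⟨e, he⟩ := hr.exists_iso _ (isLoc_toLoc (Submonoid.powers r))
    obtain ⟨e', he'⟩ := (isLoc_toLoc (Submonoid.powers r)).exists_iso _ hr
    exact ⟨r, ⟨e'.hom.op, Quiver.Hom.unop_inj he'⟩, ⟨e.hom.op, Quiver.Hom.unop_inj he⟩⟩
  cov := zariskiCov V
  finite := by
    rintro X _ ⟨n, f, U, -, rfl, -⟩
    exact Set.finite_range U
  iso_mem {X} U hU := by
    refine mem_zariskiCov_of_finite (ι := Unit) (fun _ => 1) (fun _ => U) (fun _ => ?_)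
      Set.range_const ?_
    · exact isLoc_of_isIso U.hom.unop
    · rw [Set.range_const, Idl.span_one]
  superset_mem {X S T} hST hT hS := by
    obtain ⟨n, f, U, hU, rfl, hf⟩ := hS
    obtain ⟨m, g, W, hW, rfl⟩ := exists_elements hT
    refine mem_zariskiCov_of_finite (Sum.elim f g) (Sum.elim U W) (fun i => ?_) ?_ ?_
    · cases i with
      | inl i => exact hU i
      | inr i => exact hW i
    · rw [Set.Sum.elim_range, Set.union_eq_right.mpr hST]
    · rw [Set.Sum.elim_range]
      exact le_antisymm (Idl.le_one _)
        (hf.symm.le.trans (Idl.span_mono Set.subset_union_left))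
  pull_mem := zariski_pull_mem
  trans_mem := zariski_trans_mem

end WAlg

end

/-!
Write `R_a` for the localization of `R` at the powers of `a`. A localization of finite type of `R`
is determined by any element `a` at which it is `R_a`, so a factorization condition imposed on all
of them is a condition on elements: `R → B` factors through `R_a` if and only if it maps `a` to a
unit. Hence both scheme conditions say that the restriction `O(U) → O(T)` inverts every `a` whose
class in the lattice has support containing `T`; the classes are `α₂(a) ∈ α₁(R)` for `𝒜`-schemes
and `{R_a → R} ∈ Ω₁(R)` for weak schemes.

It remains to identify the lattices. An `x ∈ α₁(R)` becomes `⊤` in `α₁(R_a)` if and only if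
`α₂(a) ≤ x`, so the ideal class of `(f_i)` is the least `x` that becomes `⊤` in every `α₁(R_{f_i})`.
Thus this class depends only on the family `{R_{f_i} → R}`. Since the family is a covering if and
only if the class is `⊤`, the order `≺` on families is the order on ideal classes. This gives a
natural isomorphism `Ω₁ ≅ α₁` that takes `{R_a → R}` to `α₂(a)`; along it, a support morphism for
one lattice functor is a support morphism for the other.
-/

noncomputable section

namespace WAlg

open CohSite CohSite.EOver

variable {V : AlgType.{u}} {R A : WAlg V}

lemma Idl.pow_mem_pow {I : Idl R} {a : R} (ha : a ∈ I) (n : ℕ) : a ^ n ∈ I ^ n := by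
  induction n with
  | zero => rw [pow_zero, pow_zero]; exact mem_one _
  | succ n ih => rw [pow_succ, pow_succ]; exact mul_mem_mul ih ha

namespace RadIdl

lemma fg_span {s : Set R} (hs : s.Finite) : (Idl.span s).FG := ⟨s, hs, rfl⟩

lemma principal_le_mk_iff {a : R} {J : Idl R} {hJ : J.FG} :
    principal a ≤ mk J hJ ↔ ∃ n : ℕ, a ^ n ∈ J := by
  refine mk_le_iff.trans ⟨fun ⟨n, h⟩ => ⟨n, h (Idl.pow_mem_pow (Idl.subset_span {a} rfl) n)⟩,
    fun h => Idl.pow_span_le (Set.finite_singleton a) ?_⟩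
  rintro _ rfl
  exact h

lemma mk_span_le_iff {s : Set R} (hs : s.Finite) (x : RadIdl R) :
    mk (Idl.span s) (fg_span hs) ≤ x ↔ ∀ a ∈ s, principal a ≤ x := by
  induction x using ind with
  | h J hJ =>
    refine ⟨fun h a ha => le_trans ?_ h, fun h =>
      mk_le_iff.mpr (Idl.pow_span_le hs fun a ha => principal_le_mk_iff.mp (h a ha))⟩
    exact principal_le_mk_iff.mpr ⟨1, (pow_one a).symm ▸ Idl.subset_span s ha⟩

lemma principal_le_principal_pow (a : R) (n : ℕ) : principal a ≤ principal (a ^ n) :=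
  principal_le_mk_iff.mpr ⟨n, Idl.subset_span _ rfl⟩

lemma mk_eq_top_iff {I : Idl R} {hI : I.FG} : mk I hI = ⊤ ↔ I = 1 := by
  refine ⟨fun h => ?_, fun h => by subst h; rfl⟩
  obtain ⟨n, hn⟩ := mk_le_iff.mp (show mk 1 fg_one ≤ mk I hI from h.ge)
  rw [one_pow] at hn
  exact le_antisymm (Idl.le_one I) hn

lemma principal_le_iff_map_eq_top {a : R} {g : R ⟶ A} (hg : IsLoc (Submonoid.powers a) g)
    (x : RadIdl R) : principal a ≤ x ↔ map g x = ⊤ := by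
  rw [← top_le_iff, ← map_top (map g), map_le_iff hg]
  constructor
  · exact fun h => ⟨a, Submonoid.mem_powers a, inf_le_right.trans h⟩
  · rintro ⟨_, ⟨n, rfl⟩, h⟩
    exact (principal_le_principal_pow a n).trans ((le_inf le_top le_rfl).trans h)

end RadIdl

section FiniteTypeLocalizations

variable {B : WAlg V}

lemma IsLoc.exists_fac_iff {S : Submonoid R} {g : R ⟶ A} (hg : IsLoc S g) (h : R ⟶ B) :
    (∃ k, g ≫ k = h) ↔ ∀ s ∈ S, IsUnit (h.hom s) := by
  refine ⟨?_, fun hh => (hg.2 B h hh).exists⟩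
  rintro ⟨k, rfl⟩ s hs
  exact (hg.1 s hs).map k.hom

lemma fac_iff_isUnit (h : R ⟶ B) (j : EOver (finTypeLoc V) (op R)) {a : R}
    (ha : IsLoc (Submonoid.powers a) j.hom.unop) : Fac h.op j ↔ IsUnit (h.hom a) := by
  rw [← isUnit_powers_iff, ← ha.exists_fac_iff]
  exact ⟨fun ⟨m, hm⟩ => ⟨m.unop, congrArg Quiver.Hom.unop hm⟩,
    fun ⟨k, hk⟩ => ⟨k.op, Quiver.Hom.unop_inj hk⟩⟩

/-- An element `a` of `R`, chosen arbitrarily, such that a given localization of finite type of `R`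
is the localization at the powers of `a`. -/
def denominator {X : (WAlg V)ᵒᵖ} (U : EOver (finTypeLoc V) X) : X.unop :=
  ((finTypeLoc_iff U.hom).mp U.prop).choose

lemma isLoc_denominator {X : (WAlg V)ᵒᵖ} (U : EOver (finTypeLoc V) X) :
    IsLoc (Submonoid.powers (denominator U)) U.hom.unop :=
  ((finTypeLoc_iff U.hom).mp U.prop).choose_spec

/-- The basic localization `R_a → R`, as a morphism of the opposite category. -/
def basicOpen {X : (WAlg V)ᵒᵖ} (a : X.unop) : EOver (finTypeLoc V) X :=
  ⟨op (loc (Submonoid.powers a)), (toLoc (Submonoid.powers a)).op,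
    (finTypeLoc_iff _).mpr ⟨a, isLoc_toLoc _⟩⟩

lemma isLoc_basicOpen {X : (WAlg V)ᵒᵖ} (a : X.unop) :
    IsLoc (Submonoid.powers a) (basicOpen a).hom.unop := isLoc_toLoc _

end FiniteTypeLocalizations

section RadicalClass

variable {X : (WAlg V)ᵒᵖ} {S : Set (EOver (finTypeLoc V) X)} (hS : S.Finite)

/-- The class in `α₁(R)` of a finite family of localizations `R_{f_i} → R`, generated by the `f_i`.
It does not depend on the choice of the `f_i`, by `radClass_le_iff`. -/
def radClass : RadIdl X.unop :=
  RadIdl.mk (Idl.span (denominator '' S)) (RadIdl.fg_span (hS.image _))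

lemma radClass_le_iff (x : RadIdl X.unop) :
    radClass hS ≤ x ↔ ∀ U ∈ S, RadIdl.map U.hom.unop x = ⊤ := by
  rw [radClass, RadIdl.mk_span_le_iff (hS.image _), Set.forall_mem_image]
  exact forall₂_congr fun U _ => RadIdl.principal_le_iff_map_eq_top (isLoc_denominator U) x

lemma radClass_range {ι : Type*} [Finite ι] (f : ι → X.unop) {U : ι → EOver (finTypeLoc V) X}
    (h : ∀ i, IsLoc (Submonoid.powers (f i)) (U i).hom.unop) (hU : (Set.range U).Finite) :
    radClass hU = RadIdl.mk (Idl.span (Set.range f)) (RadIdl.fg_span (Set.finite_range f)) := by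
  refine eq_of_forall_ge_iff fun x => ?_
  rw [radClass_le_iff, RadIdl.mk_span_le_iff (Set.finite_range f), Set.forall_mem_range,
    Set.forall_mem_range]
  exact forall_congr' fun i => (RadIdl.principal_le_iff_map_eq_top (h i) x).symm

lemma radClass_singleton (U : EOver (finTypeLoc V) X) {a : X.unop}
    (h : IsLoc (Submonoid.powers a) U.hom.unop) :
    radClass (Set.finite_singleton U) = RadIdl.principal a := by
  refine eq_of_forall_ge_iff fun x => ?_
  rw [radClass_le_iff, RadIdl.principal_le_iff_map_eq_top h]
  simp only [Set.mem_singleton_iff, forall_eq]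

lemma map_radClass {Y : (WAlg V)ᵒᵖ} (f : Y ⟶ X) :
    RadIdl.map f.unop (radClass hS) =
      RadIdl.mk (Idl.span (f.unop.hom '' (denominator '' S)))
        (RadIdl.fg_span ((hS.image _).image _)) := by
  rw [radClass, RadIdl.map_mk]
  congr 1
  exact Idl.map_span _ _

lemma radClass_pull {Y : (WAlg V)ᵒᵖ} (f : Y ⟶ X) :
    radClass (hS.image (pull f)) = RadIdl.map f.unop (radClass hS) := by
  refine eq_of_forall_ge_iff fun x => ?_
  rw [map_radClass, radClass_le_iff, RadIdl.mk_span_le_iff ((hS.image _).image _),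
    Set.forall_mem_image, Set.forall_mem_image, Set.forall_mem_image]
  exact forall₂_congr fun U _ =>
    (RadIdl.principal_le_iff_map_eq_top (isLoc_pull f U (isLoc_denominator U)) x).symm

lemma mem_zariskiCov_iff : S ∈ zariskiCov V X ↔ radClass hS = ⊤ := by
  constructor
  · rintro ⟨n, f, U, hU, rfl, hf⟩
    rwa [radClass_range f hU, RadIdl.mk_eq_top_iff]
  · intro h
    obtain ⟨n, f, U, hU, rfl⟩ := exists_elements hS
    rw [radClass_range f hU, RadIdl.mk_eq_top_iff] at h
    exact ⟨n, f, U, hU, rfl, h⟩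

lemma prec_iff_radClass_le (S T : (zariskiSite V).Omega0 X) :
    S.Prec T ↔ radClass S.2 ≤ radClass T.2 := by
  refine (forall₂_congr fun U _ => ?_).trans (radClass_le_iff S.2 _).symm
  exact (mem_zariskiCov_iff (T.2.image _)).trans (radClass_pull T.2 U.hom).congr_left

lemma exists_radClass_eq (x : RadIdl X.unop) :
    ∃ S : (zariskiSite V).Omega0 X, radClass S.2 = x := by
  induction x using RadIdl.ind with
  | h I hI =>
    obtain ⟨s, hs, rfl⟩ := hI
    have := hs.to_subtype
    refine ⟨⟨_, Set.finite_range fun a : s => basicOpen a.1⟩, ?_⟩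
    refine (radClass_range Subtype.val (fun a => isLoc_basicOpen a.1) _).trans ?_
    simp only [Subtype.range_val]

end RadicalClass

section LatticeComparison

/-- The identification of `Ω₁(R)` for the Zariski topology with `α₁(R)`. -/
def omegaOrderIso (X : (WAlg V)ᵒᵖ) : (zariskiSite V).Omega1 X ≃o RadIdl X.unop :=
  RelIso.ofSurjective
    (OrderEmbedding.ofMapLEIff
      (Quotient.lift (fun S => radClass S.2) fun S T h =>
        le_antisymm ((prec_iff_radClass_le S T).mp h.1) ((prec_iff_radClass_le T S).mp h.2))
      (Omega1.ind fun S => Omega1.ind fun T => (prec_iff_radClass_le S T).symm))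
    fun x => (exists_radClass_eq x).imp' Omega1.mk fun _ h => h

lemma omegaOrderIso_map {X Y : (WAlg V)ᵒᵖ} (f : Y ⟶ X) (x : (zariskiSite V).Omega1 X) :
    omegaOrderIso Y (Omega1.map f x) = RadIdl.map f.unop (omegaOrderIso X x) := by
  induction x using Omega1.ind with
  | h S => exact radClass_pull S.2 f

variable (V) in
/-- The natural isomorphism between `Ω₁` for the Zariski topology and `α₁`. -/
def omegaIsoRad : Coh.omegaLattice (zariskiSite V) ≅ radFunctor V :=
  NatIso.ofComponents
    (fun R => BddDistLat.Iso.mk ((shrinkIso ((zariskiSite V).Omega1 (op R))).symm.trans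
      (omegaOrderIso (op R))))
    fun {R S} f => by
      refine BddDistLat.ext fun x => ?_
      change omegaOrderIso (op S) ((shrinkIso _).symm (omegaMap f.op x)) =
        RadIdl.map f (omegaOrderIso (op R) ((shrinkIso _).symm x))
      exact (congrArg (omegaOrderIso (op S)) (OrderIso.symm_apply_apply _ _)).trans
        (omegaOrderIso_map f.op _)

/-- The class `{R_a → R}` in `Ω₁(R)`, the counterpart of `α₂(a)`. -/
def basicClass (R : WAlg V) (a : R) : (Coh.omegaLattice (zariskiSite V)).obj R :=
  Coh.singleClass (zariskiSite V) (basicOpen (X := op R) a)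

lemma omegaIsoRad_singleClass (j : EOver (finTypeLoc V) (op R)) {a : R}
    (h : IsLoc (Submonoid.powers a) j.hom.unop) :
    (omegaIsoRad V).hom.app R (Coh.singleClass (zariskiSite V) j) = RadIdl.principal a := by
  change omegaOrderIso (op R) ((shrinkIso _).symm (shrinkIso _ _)) = _
  rw [OrderIso.symm_apply_apply]
  exact radClass_singleton j h

lemma omegaIsoRad_basicClass (R : WAlg V) (a : R) :
    (omegaIsoRad V).hom.app R (basicClass R a) = RadIdl.principal a :=
  omegaIsoRad_singleClass _ (isLoc_basicOpen (X := op R) a)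

lemma singleClass_eq_basicClass (j : EOver (finTypeLoc V) (op R)) {a : R}
    (h : IsLoc (Submonoid.powers a) j.hom.unop) :
    Coh.singleClass (zariskiSite V) j = basicClass R a :=
  (ConcreteCategory.bijective_of_isIso ((omegaIsoRad V).hom.app R)).injective
    ((omegaIsoRad_singleClass j h).trans (omegaIsoRad_basicClass R a).symm)

end LatticeComparison

end WAlg

namespace Coh

/-- An equivalence of categories that respects two properties of objects restricts to an
equivalence of full subcategories. Unlike in `Equivalence.congrFullSubcategory`, neither property
has to be closed under isomorphisms. -/
def restrictEquivalence {C D : Type*} [Category* C] [Category* D] {P : ObjectProperty C}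
    {Q : ObjectProperty D} (e : C ≌ D) (hPQ : ∀ X, P X → Q (e.functor.obj X))
    (hQP : ∀ Y, Q Y → P (e.inverse.obj Y)) : P.FullSubcategory ≌ Q.FullSubcategory where
  functor := Q.lift (P.ι ⋙ e.functor) fun X => hPQ X.obj X.property
  inverse := P.lift (Q.ι ⋙ e.inverse) fun Y => hQP Y.obj Y.property
  unitIso := (P.fullyFaithfulι.whiskeringRight _).preimageIso (P.ι.isoWhiskerLeft e.unitIso)
  counitIso := (Q.fullyFaithfulι.whiskeringRight _).preimageIso (Q.ι.isoWhiskerLeft e.counitIso)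
  functor_unitIso_comp X := ObjectProperty.hom_ext _ (e.functor_unit_comp X.obj)

variable {D : Type (u + 1)} [Category.{u} D] {L L' : D ⥤ BddDistLat.{u}}

section LatticeSheafTrans

variable {X : Type u} [TopologicalSpace X] [SpectralSpace X]

/-- The morphism of lattice sheaves induced by a natural transformation of lattice functors. -/
def latticeSheafTrans (η : L ⟶ L') (O : Sheaf (topology X) D) :
    latticeSheaf L O ⟶ latticeSheaf L' O :=
  (presheafToSheaf (topology X) BddDistLat.{u}).map (Functor.whiskerLeft O.obj η)

lemma supp_latticeSheafTrans (η : L ⟶ L') {O : Sheaf (topology X) D}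
    (β : latticeSheaf L' O ⟶ tau X) {U : CompactOpens X} (a : L.obj (O.obj.obj (op U))) :
    supp L (latticeSheafTrans η O ≫ β) a = supp L' β (η.app _ a) := by
  have h : toLatticeSheaf L O ≫ (latticeSheafTrans η O).hom =
      Functor.whiskerLeft O.obj η ≫ toLatticeSheaf L' O :=
    (toSheafify_naturality (topology X) (Functor.whiskerLeft O.obj η)).symm
  exact congrArg (fun k => Subtype.val (β.hom.app (op U) (k.app (op U) a))) h

lemma supp_latticeSheafTrans_latticeSheafTrans {θ : L' ⟶ L} {η : L ⟶ L'} (h : θ ≫ η = 𝟙 L')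
    {O : Sheaf (topology X) D} (β : latticeSheaf L' O ⟶ tau X) {U : CompactOpens X}
    (a : L'.obj (O.obj.obj (op U))) :
    supp L' (latticeSheafTrans θ O ≫ latticeSheafTrans η O ≫ β) a = supp L' β a := by
  rw [supp_latticeSheafTrans, supp_latticeSheafTrans]
  exact congrArg (fun k => supp L' β (k.app (O.obj.obj (op U)) a)) h

end LatticeSheafTrans

namespace SupportedSpace

/-- The isomorphism, the identity on spaces and sheaves, between two supported spaces that differ
only in support morphisms with equal values on sections. -/
def isoOfSuppEq {X : Type u} [TopologicalSpace X] [SpectralSpace X] {O : Sheaf (topology X) D}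
    {β β' : latticeSheaf L O ⟶ tau X}
    (h : ∀ (U : CompactOpens X) (a : L.obj (O.obj.obj (op U))), supp L β a = supp L β' a) :
    (⟨X, O, β⟩ : SupportedSpace L) ≅ ⟨X, O, β'⟩ where
  hom := ⟨id, isSpectralMap_id, ⟨𝟙 O.obj⟩, (comm_iff L _ _ _ _ _).mpr fun U a =>
    (congrArg (fun k => supp L β (k a)) (L.map_id _)).trans (h U a)⟩
  inv := ⟨id, isSpectralMap_id, ⟨𝟙 O.obj⟩, (comm_iff L _ _ _ _ _).mpr fun U a =>
    (congrArg (fun k => supp L β' (k a)) (L.map_id _)).trans (h U a).symm⟩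
  hom_inv_id := Hom.ext rfl (heq_of_eq (Sheaf.hom_ext (Category.id_comp _)))
  inv_hom_id := Hom.ext rfl (heq_of_eq (Sheaf.hom_ext (Category.id_comp _)))

/-- Restriction of the support morphism along a natural transformation of lattice functors. -/
def changeLattice (η : L ⟶ L') : SupportedSpace L' ⥤ SupportedSpace L where
  obj X := { carrier := X.carrier, O := X.O, β := latticeSheafTrans η X.O ≫ X.β }
  map {X Y} f :=
    { base := f.base
      isSpectralMap := f.isSpectralMap
      sharp := f.sharp
      comm := by
        refine (comm_iff L _ _ _ _ _).mpr fun U a => ?_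
        have hX := (supp_latticeSheafTrans η X.β (L.map (f.sharp.hom.app (op U)) a)).trans
          (congrArg (supp L' X.β) (congrArg (fun k => k a)
            (η.naturality (f.sharp.hom.app (op U)))))
        have hY := congrArg (preimage f.base f.isSpectralMap) (supp_latticeSheafTrans η Y.β a)
        exact hX.trans (((comm_iff L' _ _ _ _ _).mp f.comm U (η.app _ a)).trans hY.symm) }

lemma support_changeLattice (η : L ⟶ L') (X : SupportedSpace L') {U : CompactOpens X.carrier}
    (a : L.obj (X.O.obj.obj (op U))) :
    ((changeLattice η).obj X).support (U := U) a = X.support (η.app _ a) :=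
  supp_latticeSheafTrans η X.β a

/-- Changing the lattice functor along a natural transformation and back along a section of it
gives the original supported space. -/
def changeLatticeCompIso (θ : L' ⟶ L) (η : L ⟶ L') (h : θ ≫ η = 𝟙 L') :
    changeLattice η ⋙ changeLattice θ ≅ 𝟭 (SupportedSpace L') :=
  NatIso.ofComponents
    (fun X => isoOfSuppEq fun _ => supp_latticeSheafTrans_latticeSheafTrans h X.β)
    fun f => Hom.ext rfl (heq_of_eq (Sheaf.hom_ext
      ((Category.id_comp f.sharp.hom).trans (Category.comp_id f.sharp.hom).symm)))

/-- Isomorphic lattice functors have equivalent categories of supported spaces. -/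
def changeLatticeEquivalence (e : L ≅ L') : SupportedSpace L' ≌ SupportedSpace L :=
  .mk (changeLattice e.hom) (changeLattice e.inv)
    (changeLatticeCompIso e.inv e.hom e.inv_hom_id).symm
    (changeLatticeCompIso e.hom e.inv e.hom_inv_id)

end SupportedSpace

end Coh

namespace WAlg

open Coh CohSite.EOver

variable {V : AlgType.{u}}

section InvertsOnSupport

variable {L L' : WAlg V ⥤ BddDistLat.{u}}

/-- The common form of the two scheme conditions: for quasi-compact open subsets `T ⊆ U`, the
restriction map `O(U) → O(T)` inverts every `a ∈ O(U)` such that the support of `σ(a)`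
contains `T`. -/
def InvertsOnSupport (σ : ∀ R : WAlg V, R → L.obj R) : ObjectProperty (SupportedSpace L) :=
  fun X => ∀ (T U : CompactOpens X.carrier) (h : T ≤ U) (a : X.O.obj.obj (op U)),
    T ≤ X.support (σ _ a) → IsUnit ((X.O.obj.map (homOfLE h).op).hom a)

lemma isAScheme_iff (𝒜 : SchematizableType V) (X : SupportedSpace 𝒜.α₁) :
    IsAScheme 𝒜 X ↔ InvertsOnSupport 𝒜.α₂ X :=
  forall₃_congr fun _ _ h => (isLoc_toLoc (supportSystem 𝒜 X h)).exists_fac_iff _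

lemma isWeakScheme_iff (X : SupportedSpace (omegaLattice (zariskiSite V))) :
    IsWeakScheme (zariskiSite V) X ↔ InvertsOnSupport basicClass X := by
  refine forall₃_congr fun T U h => ⟨fun H a ha => ?_, fun H j hj => ?_⟩
  · exact (fac_iff_isUnit _ _ (isLoc_basicOpen (X := op _) a)).mp (H (basicOpen a) ha)
  · refine (fac_iff_isUnit _ j (isLoc_denominator j)).mpr (H _ ?_)
    rwa [← singleClass_eq_basicClass j (isLoc_denominator j)]

lemma InvertsOnSupport.changeLattice {η : L ⟶ L'} {σ : ∀ R : WAlg V, R → L.obj R}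
    {σ' : ∀ R : WAlg V, R → L'.obj R} (h : ∀ R a, η.app R (σ R a) = σ' R a)
    {X : SupportedSpace L'} (hX : InvertsOnSupport σ' X) :
    InvertsOnSupport σ ((SupportedSpace.changeLattice η).obj X) := by
  intro T U hTU a ha
  have hsupp := (SupportedSpace.support_changeLattice η X (σ _ a)).trans
    (congrArg X.support (h _ a))
  exact hX T U hTU a (ha.trans_eq hsupp)

end InvertsOnSupport

variable (V) in
/-- The equivalence between `𝒜`-schemes and weak schemes for the Zariski topology, induced by the
isomorphism of the lattice functors. -/
def aSchemeEquivWeakScheme : AScheme (idealType V) ≌ WeakScheme (zariskiSite V) :=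
  restrictEquivalence
    (SupportedSpace.changeLatticeEquivalence (L' := (idealType V).α₁) (omegaIsoRad V))
    (fun X hX => (isWeakScheme_iff _).mpr
      (((isAScheme_iff _ X).mp hX).changeLattice omegaIsoRad_basicClass))
    (fun Y hY => (isAScheme_iff _ _).mpr
      (((isWeakScheme_iff Y).mp hY).changeLattice fun R a =>
        (congrArg _ (omegaIsoRad_basicClass R a).symm).trans
          (Iso.hom_inv_id_app_apply (omegaIsoRad V) R _)))

end WAlg

end

theorem theorem4p16_general (V : AlgType.{u}) :
    Nonempty (WAlg.AScheme (WAlg.idealType V) ≌ Coh.WeakScheme (WAlg.zariskiSite V)) :=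
  ⟨WAlg.aSchemeEquivWeakScheme V⟩

theorem theorem4p16 (V : AlgType.{u}) (hV : V.SelfEnhancing) :
    Nonempty (WAlg.AScheme (WAlg.idealType V) ≌ Coh.WeakScheme (WAlg.zariskiSite V)) :=
  theorem4p16_general V
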